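/- **Definitions.** A *Lorenz map* on $I=[a,b]$ is a map $f$ for which there is $c\in(a,b)$ such that $f$ is continuous and strictly increasing on $[a,c)$ and on $(c,b]$, takes values in $I$, and $\lim_{x\uparrow c}f(x)=b$, $\lim_{x\downarrow c}f(x)=a$. The value $f(c)$ is undefined; in images, preimages and orbits the point $c$ stands for two points $c-,c+$ with $f(c-)=b$, $f(c+)=a$, so $c$ has the images $a$ and $b$, and $c$ belongs to $f^{-1}(a)$ and $f^{-1}(b)$. $f$ is *expanding* if $\bigcup_{n\ge0}f^{-n}(c)$ is dense in $I$. Put $orb(S)=\bigcup_{n\ge0}f^n(S)$ and $\alpha(x)=\bigcap_{n\ge0}\overline{\bigcup_{k\ge n}f^{-k}(x)}$; an $\alpha$-limit set is *proper* if it is not $I$. A *renormalization* of $f$ is a Lorenz map $g$ on a proper subinterval $[u,v]\ni c$, with the same discontinuity $c$, such that for some integers $\ell,r>1$ the map $f^{\ell}$ is defined on $[u,c)$ and equals $g$ there, $f^{r}$ is defined on $(c,v]$ and equals $g$ there, and which is nondegenerate in the sense that $orb([u,v])\ne I$. It is *minimal* if $\ell\le\ell'$ and $r\le r'$ for every renormalization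 $(f^{\ell'},f^{r'})$ of $f$; the minimal renormalization is denoted $Rf$. Put $R^0f=f$, $R^{i}f=R(R^{i-1}f)$. For $0\le m\le\infty$, $f$ is *$m$ times renormalizable* if $R^if$ exists for all integers $0\le i\le m$ and, when $m<\infty$, $R^mf$ has no renormalization. Let $[a_i,b_i]$ be the interval on which $R^if$ lives, so $[a_0,b_0]=I$. For $i\ge 1$ let $J_i=\{x\in I: orb(x)\cap(a_i,b_i)=\emptyset\}$; the $i$-th renormalization is *periodic* if the endpoints $\sup\{x\in J_i:x<c\}$ and $\inf\{x\in J_i:x>c\}$ of its critical interval lie in the same periodic orbit of $f$. A *Cantor set* is a nonempty, compact, perfect, totally disconnected set; $S'$ is the set of accumulation points of $S$. **Theorem C.** Let $f$ be an $m$ times renormalizable expanding Lorenz map ($0\le m\le\infty$). Here $i$ denotes integers, and $orb$, $\alpha$ are taken with respect to $f$. 1. $f$ has exactly $m$ proper $\alpha$-limit sets, and they are the sets $E_i$, $0<i\le m$, of a strictly increasing chain $$\emptyset=E_0\subset E_1\subset E_2\subset\cdots\subset E_m\subset I$$ (an infinite chain of proper subsets of $I$ if $m=\infty$). 2. For $0<i\le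 m$: $E_i$ is a Cantor set if the $i$-th renormalization is not periodic, and $E_i'=E_{i-1}$ if the $i$-th renormalization is periodic. 3. For $0<i\le m$ and $x\in I$, $\alpha(x)=E_i$ if and only if $x\in orb([a_{i-1},b_{i-1}])\setminus orb([a_i,b_i])$. For $x\in I$, $\alpha(x)=I$ if and only if $x\in\bigcap_{0\le i\le m}orb([a_i,b_i])$. -/

import Mathlib

open Set Filter Topology

/-- A Lorenz map on `[a, b]` with discontinuity `c ∈ (a, b)`: continuous and strictly increasing on
`[a, c)` and on `(c, b]`, with `f(c-) = b` and `f(c+) = a`.  Only the values of `toFun` on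
`[a, b] \ {c}` are ever used. -/
structure LorenzMap where
  a : ℝ
  b : ℝ
  c : ℝ
  toFun : ℝ → ℝ
  a_lt_c : a < c
  c_lt_b : c < b
  mapsTo : ∀ x ∈ Icc a b, x ≠ c → toFun x ∈ Icc a b
  continuousOn_left : ContinuousOn toFun (Ico a c)
  continuousOn_right : ContinuousOn toFun (Ioc c b)
  strictMonoOn_left : StrictMonoOn toFun (Ico a c)
  strictMonoOn_right : StrictMonoOn toFun (Ioc c b)
  tendsto_left : Tendsto toFun (𝓝[<] c) (𝓝 b)
  tendsto_right : Tendsto toFun (𝓝[>] c) (𝓝 a)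

namespace LorenzMap

/-- The interval `I = [a, b]` on which the map acts. -/
def dom (f : LorenzMap) : Set ℝ := Icc f.a f.b

/-- `f.Step x y` says that `y` is an image of `x`.  The point `c` stands for the two points `c+` and
`c-`, so that its images are `f(c+) = a` and `f(c-) = b`. -/
def Step (f : LorenzMap) (x y : ℝ) : Prop :=
  x ∈ f.dom ∧ ((x ≠ f.c ∧ y = f.toFun x) ∨ (x = f.c ∧ (y = f.a ∨ y = f.b)))

/-- `f.Iter n x y` says that `y ∈ fⁿ(x)`, equivalently `x ∈ f⁻ⁿ(y)`. -/
def Iter (f : LorenzMap) : ℕ → ℝ → ℝ → Prop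
  | 0, x, y => x = y
  | n + 1, x, y => ∃ z, f.Step x z ∧ f.Iter n z y

/-- The set of `n`-th preimages of `x`. -/
def preimages (f : LorenzMap) (n : ℕ) (x : ℝ) : Set ℝ := {y | y ∈ f.dom ∧ f.Iter n y x}

/-- `orb(S) = ⋃ₙ fⁿ(S)`. -/
def orb (f : LorenzMap) (S : Set ℝ) : Set ℝ := {y | ∃ x ∈ S, ∃ n, f.Iter n x y}

/-- The `α`-limit set `⋂ₙ closure (⋃_{k ≥ n} f⁻ᵏ(x))`. -/
def alpha (f : LorenzMap) (x : ℝ) : Set ℝ :=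
  ⋂ n : ℕ, closure (⋃ k : ℕ, ⋃ _ : n ≤ k, f.preimages k x)

/-- `f` is expanding: the preimages of `c` are dense in `I`. -/
def IsExpanding (f : LorenzMap) : Prop :=
  f.dom ⊆ closure (⋃ n : ℕ, f.preimages n f.c)

/-- The Lorenz map `g`, living on a proper subinterval `[u, v] ∋ c` of the interval of `f`, is the
renormalization `(f^ℓ, f^r)` of `f`.  Since `f(c)` is undefined, `f^ℓ` has to be defined on
`[u, c)` and `f^r` on `(c, v]`.  The last field says that the renormalization is nondegenerate: the
orbit of `[u, v]` is not the whole interval. -/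
structure IsRenormalization (f g : LorenzMap) (l r : ℕ) : Prop where
  c_eq : g.c = f.c
  one_lt_l : 1 < l
  one_lt_r : 1 < r
  proper : g.dom ⊂ f.dom
  defined_left : ∀ x ∈ Ico g.a f.c, ∀ j < l, f.toFun^[j] x ≠ f.c
  defined_right : ∀ x ∈ Ioc f.c g.b, ∀ j < r, f.toFun^[j] x ≠ f.c
  eq_left : ∀ x ∈ Ico g.a f.c, g.toFun x = f.toFun^[l] x
  eq_right : ∀ x ∈ Ioc f.c g.b, g.toFun x = f.toFun^[r] x
  orb_ne : f.orb g.dom ≠ f.dom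

/-- `f` is renormalizable; otherwise it is prime. -/
def Renormalizable (f : LorenzMap) : Prop := ∃ g l r, IsRenormalization f g l r

/-- `g` is the minimal renormalization `Rf` of `f`. -/
def IsMinimalRenormalization (f g : LorenzMap) : Prop :=
  ∃ l r, IsRenormalization f g l r ∧
    ∀ g' l' r', IsRenormalization f g' l' r' → l ≤ l' ∧ r ≤ r'

/-- `f` is exactly `m` times renormalizable (`0 ≤ m ≤ ∞`), and `R i` is its `i`-th renormalization
`Rⁱf` for `0 ≤ i ≤ m`.  (The terms `R i` with `i > m` are irrelevant.) -/
structure IsRenormalizationSequence (f : LorenzMap) (m : ℕ∞) (R : ℕ → LorenzMap) : Prop where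
  zero : R 0 = f
  succ : ∀ i : ℕ, (i : ℕ∞) < m → IsMinimalRenormalization (R i) (R (i + 1))
  final : ∀ i : ℕ, (i : ℕ∞) = m → ¬ (R i).Renormalizable

/-- The repelling set of a renormalization `g` of `f`, which lives on `[u, v]`: the points of `I`
whose `f`-orbit never meets `(u, v)`. -/
def repellingSet (f g : LorenzMap) : Set ℝ :=
  {x | x ∈ f.dom ∧ ∀ n y, f.Iter n x y → y ∉ Ioo g.a g.b}

/-- The left endpoint `e₋` of the critical interval of the renormalization `g` of `f`. -/
noncomputable def critLeft (f g : LorenzMap) : ℝ := sSup {x | x ∈ f.repellingSet g ∧ x < f.c}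

/-- The right endpoint `e₊` of the critical interval of the renormalization `g` of `f`. -/
noncomputable def critRight (f g : LorenzMap) : ℝ := sInf {x | x ∈ f.repellingSet g ∧ f.c < x}

/-- The renormalization `g` of `f` is periodic: the endpoints of its critical interval belong to the
same periodic orbit of `f`. -/
def IsPeriodicRenormalization (f g : LorenzMap) : Prop :=
  (∃ n, 0 < n ∧ f.Iter n (f.critLeft g) (f.critLeft g)) ∧
    ∃ k, f.Iter k (f.critLeft g) (f.critRight g)

/-- The set of proper `α`-limit sets of `f`. -/
def properAlphaLimitSets (f : LorenzMap) : Set (Set ℝ) :=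
  {S | (∃ x ∈ f.dom, f.alpha x = S) ∧ S ≠ f.dom}

end LorenzMap

/-- A Cantor set on the line: nonempty, compact, perfect and totally disconnected. -/
def IsCantorSet (S : Set ℝ) : Prop :=
  S.Nonempty ∧ IsCompact S ∧ Perfect S ∧ IsTotallyDisconnected S

/-! An `α`-limit set either contains `c` or misses it. Since the preimages of `c` are dense, every
interval has an iterate that contains `c` while no earlier one does (`IsExpanding.exists_first`).
Hence, if preimages of `x` accumulate at `c`, they can be pulled back into every interval, and the
limit set is `I` (`IsExpanding.alpha_eq_dom`). If the limit set misses `c`, it is a closed set `E`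
invariant forwards and backwards, with a gap `(em, ep)` around `c`. The images of each half of the
gap cannot meet `E` until they cover `c`. This forces the return branches to fix `em` and `ep`, so
the return map to the gap is a Lorenz map, and in fact a renormalization
(`IsInvariant.exists_leftBranch`, `IsExpanding.exists_branches`).

Conversely, let `h` be the minimal renormalization and let `x` be off the orbit of its domain. The
limit set of `x` misses the interior of that domain, so it has a gap. Comparing return times both
ways shows that the gap has the return times of `h`. These times determine the endpoints, so all
such `x` share one gap (`IsMinimalRenormalization.exists_branches`). The gap determines the limit
set, which consists of the points of `(a, b)` that never enter it (`IsLevel.alpha_eq`). Each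
renormalization thus contributes exactly one limit set. To stay with limit sets of the original `f`,
every `Rⁱf` is treated as a first return map of `f` (`IsReturn`, `IsReturn.isLevel`). Smaller gaps
give larger limit sets, whence the chain. For a point on the orbits of all the domains, the limit
set contains `c`, because `Rᵐf` is prime or, if `m = ∞`, because the domains shrink to `c`.

For the topology, a neighbourhood of any point of `E` has an injective iterate that covers one half
of the gap together with its endpoint. An isolated point of `E` therefore makes an endpoint
isolated, and such an endpoint is mapped to the other one: this is the periodic case. In that case
`E_i` has only finitely many points in `(a_{i-1}, b_{i-1})`, so its accumulation points never enter
this interval and belong to `E_{i-1}`. The same covering argument puts preimages of the endpoints of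
the smaller gap next to every point of `E_{i-1}`. -/

theorem image_Ioo_of_tendsto {F : ℝ → ℝ} {p q A B : ℝ} (hpq : p < q)
    (hm : StrictMonoOn F (Ioo p q)) (hc : ContinuousOn F (Ioo p q))
    (hA : Tendsto F (𝓝[>] p) (𝓝 A)) (hB : Tendsto F (𝓝[<] q) (𝓝 B)) :
    A < B ∧ F '' Ioo p q = Ioo A B := by
  have hlow : ∀ y, A < y → ∃ x ∈ Ioo p q, F x < y := fun y hy =>
    ((eventually_mem_set.2 (Ioo_mem_nhdsGT hpq)).and (hA.eventually (eventually_lt_nhds hy))).exists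
      |>.imp fun x hx => ⟨hx.1, hx.2⟩
  have hup : ∀ y, y < B → ∃ x ∈ Ioo p q, y < F x := fun y hy =>
    ((eventually_mem_set.2 (Ioo_mem_nhdsLT hpq)).and (hB.eventually (eventually_gt_nhds hy))).exists
      |>.imp fun x hx => ⟨hx.1, hx.2⟩
  have hAle : ∀ x ∈ Ioo p q, A ≤ F x := by
    intro x hx
    refine le_of_tendsto hA ?_
    filter_upwards [Ioo_mem_nhdsGT hx.1] with y hy
    exact (hm ⟨hy.1, hy.2.trans hx.2⟩ hx hy.2).le
  have hBge : ∀ x ∈ Ioo p q, F x ≤ B := by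
    intro x hx
    refine ge_of_tendsto hB ?_
    filter_upwards [Ioo_mem_nhdsLT hx.2] with y hy
    exact (hm hx ⟨hx.1.trans hy.1, hy.2⟩ hy.1).le
  have hAlt : ∀ x ∈ Ioo p q, A < F x := by
    intro x hx
    obtain ⟨y, hy⟩ := exists_between hx.1
    have hy' : y ∈ Ioo p q := ⟨hy.1, hy.2.trans hx.2⟩
    exact (hAle y hy').trans_lt (hm hy' hx hy.2)
  have hBgt : ∀ x ∈ Ioo p q, F x < B := by
    intro x hx
    obtain ⟨y, hy⟩ := exists_between hx.2
    have hy' : y ∈ Ioo p q := ⟨hx.1.trans hy.1, hy.2⟩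
    exact (hm hx hy' hy.1).trans_le (hBge y hy')
  obtain ⟨x₀, hx₀⟩ := exists_between hpq
  refine ⟨(hAlt x₀ hx₀).trans (hBgt x₀ hx₀), Subset.antisymm ?_ ?_⟩
  · rintro _ ⟨x, hx, rfl⟩
    exact ⟨hAlt x hx, hBgt x hx⟩
  · intro y hy
    obtain ⟨x₁, hx₁, h₁⟩ := hlow y hy.1
    obtain ⟨x₂, hx₂, h₂⟩ := hup y hy.2
    exact isPreconnected_Ioo.intermediate_value hx₁ hx₂ hc ⟨h₁.le, h₂.le⟩

/-! ### Reflection, one-sided images and injective branches of iterates. -/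

namespace LorenzMap

variable {f g h : LorenzMap}

/-- The image `f(x+)`. -/
noncomputable def plus (f : LorenzMap) (x : ℝ) : ℝ := if x = f.c then f.a else f.toFun x

/-- The image `f(x-)`. -/
noncomputable def minus (f : LorenzMap) (x : ℝ) : ℝ := if x = f.c then f.b else f.toFun x

/-- The map `x ↦ -f(-x)`. -/
def reflect (f : LorenzMap) : LorenzMap where
  a := -f.b
  b := -f.a
  c := -f.c
  toFun x := -f.toFun (-x)
  a_lt_c := neg_lt_neg f.c_lt_b
  c_lt_b := neg_lt_neg f.a_lt_c
  mapsTo x hx hc := by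
    have := f.mapsTo (-x) ⟨by linarith [hx.2], by linarith [hx.1]⟩ (fun h => hc (by linarith))
    exact ⟨by linarith [this.2], by linarith [this.1]⟩
  continuousOn_left := (f.continuousOn_right.comp continuous_neg.continuousOn
    (fun x hx => ⟨by linarith [hx.2], by linarith [hx.1]⟩)).neg
  continuousOn_right := (f.continuousOn_left.comp continuous_neg.continuousOn
    (fun x hx => ⟨by linarith [hx.2], by linarith [hx.1]⟩)).neg
  strictMonoOn_left x hx y hy hxy := neg_lt_neg (f.strictMonoOn_right
    (show -y ∈ Ioc f.c f.b from ⟨by linarith [hy.2], by linarith [hy.1]⟩)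
    (show -x ∈ Ioc f.c f.b from ⟨by linarith [hx.2], by linarith [hx.1]⟩) (neg_lt_neg hxy))
  strictMonoOn_right x hx y hy hxy := neg_lt_neg (f.strictMonoOn_left
    (show -y ∈ Ico f.a f.c from ⟨by linarith [hy.2], by linarith [hy.1]⟩)
    (show -x ∈ Ico f.a f.c from ⟨by linarith [hx.2], by linarith [hx.1]⟩) (neg_lt_neg hxy))
  tendsto_left := by
    have h : Tendsto (fun x : ℝ => -x) (𝓝[<] (-f.c)) (𝓝[>] f.c) := by
      simpa using tendsto_neg_nhdsLT (a := -f.c)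
    exact (f.tendsto_right.comp h).neg
  tendsto_right := by
    have h : Tendsto (fun x : ℝ => -x) (𝓝[>] (-f.c)) (𝓝[<] f.c) := by
      simpa using tendsto_neg_nhdsGT (a := -f.c)
    exact (f.tendsto_left.comp h).neg

@[simp] theorem reflect_a : f.reflect.a = -f.b := rfl
@[simp] theorem reflect_b : f.reflect.b = -f.a := rfl
@[simp] theorem reflect_c : f.reflect.c = -f.c := rfl
theorem reflect_toFun (x : ℝ) : f.reflect.toFun x = -f.toFun (-x) := rfl

@[simp] theorem reflect_reflect : f.reflect.reflect = f := by
  cases f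
  simp [reflect]

theorem reflect_iterate (n : ℕ) (x : ℝ) : f.reflect.toFun^[n] x = -f.toFun^[n] (-x) := by
  induction n with
  | zero => simp
  | succ n ih => rw [Function.iterate_succ_apply', ih, Function.iterate_succ_apply', reflect_toFun,
      neg_neg]

theorem reflect_plus (x : ℝ) : f.reflect.plus x = -f.minus (-x) := by
  simp only [plus, minus, reflect_c, reflect_a, reflect_toFun, neg_eq_iff_eq_neg]
  split_ifs <;> simp_all

theorem reflect_minus (x : ℝ) : f.reflect.minus x = -f.plus (-x) := by
  simp only [plus, minus, reflect_c, reflect_b, reflect_toFun, neg_eq_iff_eq_neg]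
  split_ifs <;> simp_all

theorem reflect_plus_iterate (n : ℕ) (x : ℝ) : f.reflect.plus^[n] x = -f.minus^[n] (-x) := by
  induction n with
  | zero => simp
  | succ n ih => rw [Function.iterate_succ_apply', ih, Function.iterate_succ_apply', reflect_plus,
      neg_neg]

theorem reflect_minus_iterate (n : ℕ) (x : ℝ) : f.reflect.minus^[n] x = -f.plus^[n] (-x) := by
  induction n with
  | zero => simp
  | succ n ih => rw [Function.iterate_succ_apply', ih, Function.iterate_succ_apply', reflect_minus,
      neg_neg]

theorem mem_dom_reflect {x : ℝ} : x ∈ f.reflect.dom ↔ -x ∈ f.dom := by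
  simp only [dom, mem_Icc, reflect_a, reflect_b]
  constructor <;> rintro ⟨h₁, h₂⟩ <;> constructor <;> linarith

theorem a_lt_b : f.a < f.b := f.a_lt_c.trans f.c_lt_b
theorem c_mem_dom : f.c ∈ f.dom := ⟨f.a_lt_c.le, f.c_lt_b.le⟩
theorem a_mem_dom : f.a ∈ f.dom := ⟨le_rfl, f.a_lt_b.le⟩
theorem b_mem_dom : f.b ∈ f.dom := ⟨f.a_lt_b.le, le_rfl⟩
theorem Ioo_subset_dom : Ioo f.a f.b ⊆ f.dom := Ioo_subset_Icc_self

theorem toFun_lt_b {x : ℝ} (hx : x ∈ Ico f.a f.c) : f.toFun x < f.b := by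
  obtain ⟨y, hy⟩ := exists_between hx.2
  have hy' : y ∈ Ico f.a f.c := ⟨hx.1.trans hy.1.le, hy.2⟩
  exact (f.strictMonoOn_left hx hy' hy.1).trans_le
    (f.mapsTo y ⟨hy'.1, hy.2.le.trans f.c_lt_b.le⟩ hy.2.ne).2

theorem a_lt_toFun {x : ℝ} (hx : x ∈ Ioc f.c f.b) : f.a < f.toFun x := by
  have := f.reflect.toFun_lt_b (x := -x) ⟨neg_le_neg hx.2, neg_lt_neg hx.1⟩
  simp only [reflect_toFun, neg_neg, reflect_b] at this
  linarith

theorem toFun_mem_Ioo {x : ℝ} (hx : x ∈ Ioo f.a f.b) (hc : x ≠ f.c) :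
    f.toFun x ∈ Ioo f.a f.b := by
  rcases lt_or_gt_of_ne hc with h | h
  · exact ⟨(f.mapsTo f.a f.a_mem_dom f.a_lt_c.ne).1.trans_lt
      (f.strictMonoOn_left ⟨le_rfl, f.a_lt_c⟩ ⟨hx.1.le, h⟩ hx.1), toFun_lt_b ⟨hx.1.le, h⟩⟩
  · exact ⟨a_lt_toFun ⟨h, hx.2.le⟩, (f.strictMonoOn_right ⟨h, hx.2.le⟩ ⟨f.c_lt_b, le_rfl⟩
      hx.2).trans_le (f.mapsTo f.b f.b_mem_dom f.c_lt_b.ne').2⟩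

theorem plus_of_ne {x : ℝ} (hx : x ≠ f.c) : f.plus x = f.toFun x := if_neg hx
theorem minus_of_ne {x : ℝ} (hx : x ≠ f.c) : f.minus x = f.toFun x := if_neg hx
@[simp] theorem plus_c : f.plus f.c = f.a := if_pos rfl
@[simp] theorem minus_c : f.minus f.c = f.b := if_pos rfl

theorem tendsto_minus {q : ℝ} (ha : f.a < q) (hb : q ≤ f.b) :
    Tendsto f.toFun (𝓝[<] q) (𝓝 (f.minus q)) := by
  rcases lt_trichotomy q f.c with h | rfl | h
  · rw [minus_of_ne h.ne]
    refine (f.continuousOn_left q ⟨ha.le, h⟩).mono_left ?_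
    exact nhdsWithin_le_of_mem (mem_of_superset (Ioo_mem_nhdsLT ha)
      fun x hx => ⟨hx.1.le, hx.2.trans h⟩)
  · rw [minus_c]; exact f.tendsto_left
  · rw [minus_of_ne h.ne']
    refine (f.continuousOn_right q ⟨h, hb⟩).mono_left ?_
    exact nhdsWithin_le_of_mem (mem_of_superset (Ioo_mem_nhdsLT h)
      fun x hx => ⟨hx.1, hx.2.le.trans hb⟩)

theorem tendsto_plus {p : ℝ} (ha : f.a ≤ p) (hb : p < f.b) :
    Tendsto f.toFun (𝓝[>] p) (𝓝 (f.plus p)) := by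
  have h₁ := f.reflect.tendsto_minus (q := -p) (neg_lt_neg hb) (neg_le_neg ha)
  rw [reflect_minus, neg_neg] at h₁
  have h₂ : Tendsto (fun x : ℝ => -x) (𝓝[>] p) (𝓝[<] (-p)) := tendsto_neg_nhdsGT
  simpa [Function.comp_def, reflect_toFun] using (h₁.comp h₂).neg

theorem strictMonoOn_of_notMem {S : Set ℝ} (hS : S.OrdConnected) (hd : S ⊆ f.dom) (hc : f.c ∉ S) :
    StrictMonoOn f.toFun S ∧ ContinuousOn f.toFun S ∧
      ((S ⊆ Ico f.a f.c) ∨ S ⊆ Ioc f.c f.b) := by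
  have : (S ⊆ Ico f.a f.c) ∨ S ⊆ Ioc f.c f.b := by
    by_cases h : ∃ x ∈ S, x < f.c
    · obtain ⟨x, hx, hxc⟩ := h
      left
      intro y hy
      refine ⟨(hd hy).1, lt_of_not_ge fun hcy => hc (hS.out hx hy ⟨hxc.le, hcy⟩)⟩
    · right
      push Not at h
      intro y hy
      exact ⟨lt_of_le_of_ne (h y hy) fun e => hc (e ▸ hy), (hd hy).2⟩
  refine ⟨?_, ?_, this⟩ <;> rcases this with h | h
  · exact f.strictMonoOn_left.mono h
  · exact f.strictMonoOn_right.mono h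
  · exact f.continuousOn_left.mono h
  · exact f.continuousOn_right.mono h

theorem image_Ioo {p q : ℝ} (hp : f.a ≤ p) (hpq : p < q) (hq : q ≤ f.b) (hc : f.c ∉ Ioo p q) :
    f.plus p < f.minus q ∧ f.toFun '' Ioo p q = Ioo (f.plus p) (f.minus q) := by
  obtain ⟨h₁, h₂, -⟩ := f.strictMonoOn_of_notMem (S := Ioo p q) ordConnected_Ioo
    (fun x hx => ⟨hp.trans hx.1.le, hx.2.le.trans hq⟩) hc
  exact image_Ioo_of_tendsto hpq h₁ h₂ (tendsto_plus hp (hpq.trans_le hq))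
    (tendsto_minus (hp.trans_lt hpq) hq)

theorem toFun_iterate_mem_dom {x : ℝ} (hx : x ∈ f.dom) {n : ℕ}
    (hn : ∀ j < n, f.toFun^[j] x ≠ f.c) : f.toFun^[n] x ∈ f.dom := by
  induction n with
  | zero => exact hx
  | succ n ih =>
    rw [Function.iterate_succ_apply']
    exact f.mapsTo _ (ih fun j hj => hn j (by lia)) (hn n (by lia))

theorem toFun_iterate_mem_Ioo {x : ℝ} (hx : x ∈ Ioo f.a f.b) {n : ℕ}
    (hn : ∀ j < n, f.toFun^[j] x ≠ f.c) : f.toFun^[n] x ∈ Ioo f.a f.b := by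
  induction n with
  | zero => exact hx
  | succ n ih =>
    rw [Function.iterate_succ_apply']
    exact toFun_mem_Ioo (ih fun j hj => hn j (by lia)) (hn n (by lia))

theorem plus_mem_dom {x : ℝ} (hx : x ∈ f.dom) : f.plus x ∈ f.dom := by
  by_cases h : x = f.c
  · simpa [plus, h] using f.a_mem_dom
  · rw [plus_of_ne h]; exact f.mapsTo x hx h

theorem minus_mem_dom {x : ℝ} (hx : x ∈ f.dom) : f.minus x ∈ f.dom := by
  by_cases h : x = f.c
  · simpa [minus, h] using f.b_mem_dom
  · rw [minus_of_ne h]; exact f.mapsTo x hx h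

theorem plus_iterate_mem_dom {x : ℝ} (hx : x ∈ f.dom) (n : ℕ) : f.plus^[n] x ∈ f.dom := by
  induction n with
  | zero => exact hx
  | succ n ih => rw [Function.iterate_succ_apply']; exact plus_mem_dom ih

theorem minus_iterate_mem_dom {x : ℝ} (hx : x ∈ f.dom) (n : ℕ) : f.minus^[n] x ∈ f.dom := by
  induction n with
  | zero => exact hx
  | succ n ih => rw [Function.iterate_succ_apply']; exact minus_mem_dom ih

theorem plus_iterate_eq {x : ℝ} {n : ℕ} (hn : ∀ j < n, f.toFun^[j] x ≠ f.c) :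
    f.plus^[n] x = f.toFun^[n] x := by
  induction n with
  | zero => rfl
  | succ n ih => rw [Function.iterate_succ_apply', Function.iterate_succ_apply',
      ih fun j hj => hn j (by lia), plus_of_ne (hn n (by lia))]

theorem minus_iterate_eq {x : ℝ} {n : ℕ} (hn : ∀ j < n, f.toFun^[j] x ≠ f.c) :
    f.minus^[n] x = f.toFun^[n] x := by
  induction n with
  | zero => rfl
  | succ n ih => rw [Function.iterate_succ_apply', Function.iterate_succ_apply',
      ih fun j hj => hn j (by lia), minus_of_ne (hn n (by lia))]

/-- The points of `S` do not visit `c` before time `n`. -/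
def Avoids (f : LorenzMap) (n : ℕ) (S : Set ℝ) : Prop := ∀ x ∈ S, ∀ j < n, f.toFun^[j] x ≠ f.c

theorem Avoids.mono {n m : ℕ} {S T : Set ℝ} (h : f.Avoids n T) (hS : S ⊆ T) (hm : m ≤ n) :
    f.Avoids m S := fun x hx j hj => h x (hS hx) j (hj.trans_le hm)

theorem Avoids.regular {n : ℕ} {S : Set ℝ} (hS : S.OrdConnected) (hd : S ⊆ f.dom)
    (h : f.Avoids n S) : StrictMonoOn f.toFun^[n] S ∧ ContinuousOn f.toFun^[n] S := by
  induction n with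
  | zero => exact ⟨strictMono_id.strictMonoOn _, continuousOn_id⟩
  | succ n ih =>
    obtain ⟨h₁, h₂⟩ := ih (h.mono Subset.rfl (by lia))
    have hT : (f.toFun^[n] '' S).OrdConnected :=
      (hS.isPreconnected.image _ h₂).ordConnected
    have hTd : f.toFun^[n] '' S ⊆ f.dom := by
      rintro _ ⟨x, hx, rfl⟩
      exact toFun_iterate_mem_dom (hd hx) fun j hj => h x hx j (by lia)
    have hTc : f.c ∉ f.toFun^[n] '' S := by
      rintro ⟨x, hx, e⟩
      exact h x hx n (by lia) e
    obtain ⟨h₃, h₄, -⟩ := f.strictMonoOn_of_notMem hT hTd hTc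
    rw [Function.iterate_succ']
    exact ⟨h₃.comp h₁ (mapsTo_image _ _), h₄.comp h₂ (mapsTo_image _ _)⟩

theorem Avoids.side {n : ℕ} {S : Set ℝ} (hS : S.OrdConnected) (hd : S ⊆ f.dom)
    (h : f.Avoids (n + 1) S) :
    (∀ x ∈ S, f.toFun^[n] x ∈ Ico f.a f.c) ∨ ∀ x ∈ S, f.toFun^[n] x ∈ Ioc f.c f.b := by
  have hT : (f.toFun^[n] '' S).OrdConnected :=
    (hS.isPreconnected.image _ (h.mono Subset.rfl (by lia) |>.regular hS hd).2).ordConnected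
  have hTd : f.toFun^[n] '' S ⊆ f.dom := by
    rintro _ ⟨x, hx, rfl⟩
    exact toFun_iterate_mem_dom (hd hx) fun j hj => h x hx j (by lia)
  have hTc : f.c ∉ f.toFun^[n] '' S := by
    rintro ⟨x, hx, e⟩
    exact h x hx n (by lia) e
  rcases (f.strictMonoOn_of_notMem hT hTd hTc).2.2 with h | h
  · exact Or.inl fun x hx => h (mem_image_of_mem _ hx)
  · exact Or.inr fun x hx => h (mem_image_of_mem _ hx)

/-- The one-sided orbits of `p+` and `q-` carry the endpoints of the successive images, even when
the endpoints themselves visit `c`. -/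
theorem Avoids.image_Ioo {p q : ℝ} (hp : f.a ≤ p) (hpq : p < q) (hq : q ≤ f.b) {n : ℕ}
    (h : f.Avoids n (Ioo p q)) :
    f.plus^[n] p < f.minus^[n] q ∧
      f.toFun^[n] '' Ioo p q = Ioo (f.plus^[n] p) (f.minus^[n] q) := by
  induction n with
  | zero => exact ⟨hpq, by simp⟩
  | succ n ih =>
    obtain ⟨h₁, h₂⟩ := ih (h.mono Subset.rfl (by lia))
    have hc : f.c ∉ Ioo (f.plus^[n] p) (f.minus^[n] q) := by
      rw [← h₂]
      rintro ⟨x, hx, e⟩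
      exact h x hx n (by lia) e
    rw [Function.iterate_succ_apply', Function.iterate_succ_apply', Function.iterate_succ',
      image_comp, h₂]
    exact LorenzMap.image_Ioo (plus_iterate_mem_dom ⟨hp, hpq.le.trans hq⟩ n).1 h₁
      (minus_iterate_mem_dom ⟨hp.trans hpq.le, hq⟩ n).2 hc

theorem Avoids.succ_Ioo {p q : ℝ} (hp : f.a ≤ p) (hpq : p < q) (hq : q ≤ f.b) {n : ℕ}
    (h : f.Avoids n (Ioo p q)) (hc : f.c ∉ Ioo (f.plus^[n] p) (f.minus^[n] q)) :
    f.Avoids (n + 1) (Ioo p q) := by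
  intro x hx j hj e
  rcases Nat.lt_succ_iff_lt_or_eq.1 hj with hj | rfl
  · exact h x hx j hj e
  · rw [← (h.image_Ioo hp hpq hq).2] at hc
    exact hc ⟨x, hx, e⟩

theorem tendsto_of_image_Ioo {F : ℝ → ℝ} {p q A B : ℝ} (hpq : p < q)
    (hm : StrictMonoOn F (Ioo p q)) (hF : F '' Ioo p q = Ioo A B) (hAB : A < B) :
    Tendsto F (𝓝[>] p) (𝓝 A) ∧ Tendsto F (𝓝[<] q) (𝓝 B) := by
  have hn : (Ioo p q).Nonempty := nonempty_Ioo.2 hpq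
  constructor
  · have := hm.monotoneOn.tendsto_nhdsWithin_Ioo_right hn (hF ▸ bddBelow_Ioo)
    rwa [hF, csInf_Ioo hAB] at this
  · have := hm.monotoneOn.tendsto_nhdsWithin_Ioo_left hn (hF ▸ bddAbove_Ioo)
    rwa [hF, csSup_Ioo hAB] at this

theorem Avoids.tendsto {p q : ℝ} (hp : f.a ≤ p) (hpq : p < q) (hq : q ≤ f.b) {n : ℕ}
    (h : f.Avoids n (Ioo p q)) :
    Tendsto f.toFun^[n] (𝓝[>] p) (𝓝 (f.plus^[n] p)) ∧
      Tendsto f.toFun^[n] (𝓝[<] q) (𝓝 (f.minus^[n] q)) :=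
  tendsto_of_image_Ioo hpq
    (h.regular ordConnected_Ioo fun _ hx => ⟨hp.trans hx.1.le, hx.2.le.trans hq⟩).1
    (h.image_Ioo hp hpq hq).2 (h.image_Ioo hp hpq hq).1

/-- A point whose orbit avoids `c` has a neighbourhood of such points. -/
theorem eventually_avoids {z : ℝ} (hz : z ∈ Ioo f.a f.b) {n : ℕ}
    (hn : ∀ j < n, f.toFun^[j] z ≠ f.c) :
    ContinuousAt f.toFun^[n] z ∧ ∀ᶠ w in 𝓝 z, ∀ j < n, f.toFun^[j] w ≠ f.c := by
  induction n with
  | zero => exact ⟨continuousAt_id, by simp⟩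
  | succ n ih =>
    obtain ⟨h₁, h₂⟩ := ih fun j hj => hn j (by lia)
    have hm := toFun_iterate_mem_Ioo hz (n := n) fun j hj => hn j (by lia)
    have hne := hn n (by lia)
    have h₃ : ContinuousAt f.toFun (f.toFun^[n] z) := by
      rcases lt_or_gt_of_ne hne with h | h
      · exact f.continuousOn_left.continuousAt (Ico_mem_nhds hm.1 h)
      · exact f.continuousOn_right.continuousAt (Ioc_mem_nhds h hm.2)
    refine ⟨by rw [Function.iterate_succ']; exact h₃.comp h₁, ?_⟩
    filter_upwards [h₂, h₁.eventually_ne hne] with w hw hw' j hj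
    rcases Nat.lt_succ_iff_lt_or_eq.1 hj with hj | rfl
    · exact hw j hj
    · exact hw'

end LorenzMap

/-! ### Paths of the two-valued map. -/

namespace LorenzMap
variable {f g h : LorenzMap}

theorem step_iff {x y : ℝ} : f.Step x y ↔ x ∈ f.dom ∧ (y = f.plus x ∨ y = f.minus x) := by
  unfold Step plus minus
  by_cases h : x = f.c <;> simp [h]

theorem Step.mem_dom {x y : ℝ} (h : f.Step x y) : y ∈ f.dom := by
  obtain ⟨hx, rfl | rfl⟩ := step_iff.1 h
  · exact plus_mem_dom hx
  · exact minus_mem_dom hx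

theorem Iter.mem_dom {n : ℕ} {x y : ℝ} (h : f.Iter n x y) (hx : x ∈ f.dom) : y ∈ f.dom := by
  induction n generalizing x with
  | zero => exact (show x = y from h) ▸ hx
  | succ n ih => obtain ⟨z, hz, hzy⟩ := h; exact ih hzy hz.mem_dom

theorem Iter.trans {m n : ℕ} {x y z : ℝ} (h₁ : f.Iter m x y) (h₂ : f.Iter n y z) :
    f.Iter (m + n) x z := by
  induction m generalizing x with
  | zero => rw [Nat.zero_add]; exact (show x = y from h₁) ▸ h₂
  | succ m ih => obtain ⟨w, hw, hwy⟩ := h₁; rw [Nat.succ_add]; exact ⟨w, hw, ih hwy⟩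

theorem iter_zero {x y : ℝ} : f.Iter 0 x y ↔ x = y := Iff.rfl

theorem iter_one {x y : ℝ} : f.Iter 1 x y ↔ f.Step x y := by
  constructor
  · rintro ⟨z, hz, rfl : z = y⟩; exact hz
  · exact fun h => ⟨y, h, rfl⟩

theorem iter_plus {x : ℝ} (hx : x ∈ f.dom) (n : ℕ) : f.Iter n x (f.plus^[n] x) := by
  induction n with
  | zero => rfl
  | succ n ih =>
    rw [Function.iterate_succ_apply']
    exact ih.trans (iter_one.2 (step_iff.2 ⟨plus_iterate_mem_dom hx n, Or.inl rfl⟩))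

theorem iter_minus {x : ℝ} (hx : x ∈ f.dom) (n : ℕ) : f.Iter n x (f.minus^[n] x) := by
  induction n with
  | zero => rfl
  | succ n ih =>
    rw [Function.iterate_succ_apply']
    exact ih.trans (iter_one.2 (step_iff.2 ⟨minus_iterate_mem_dom hx n, Or.inr rfl⟩))

theorem iter_toFun {x : ℝ} (hx : x ∈ f.dom) {n : ℕ} (hn : ∀ j < n, f.toFun^[j] x ≠ f.c) :
    f.Iter n x (f.toFun^[n] x) := plus_iterate_eq hn ▸ iter_plus hx n

theorem Iter.drop {n k : ℕ} {x y : ℝ} (h : f.Iter n x y) (hk : k ≤ n)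
    (hx : ∀ j < k, f.toFun^[j] x ≠ f.c) : f.Iter (n - k) (f.toFun^[k] x) y := by
  induction k generalizing n x with
  | zero => exact h
  | succ k ih =>
    obtain ⟨n, rfl⟩ : ∃ m, n = m + 1 := ⟨n - 1, by lia⟩
    obtain ⟨z, ⟨-, hz⟩, hzy⟩ := h
    have h0 : x ≠ f.c := hx 0 (by lia)
    have hz' : z = f.toFun x := by simpa [h0] using hz
    subst hz'
    rw [Nat.add_sub_add_right, Function.iterate_succ_apply]
    exact ih hzy (by lia) fun j hj => by
      rw [← Function.iterate_succ_apply]; exact hx (j + 1) (by lia)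

theorem Iter.eq_of_avoids {n : ℕ} {x y : ℝ} (h : f.Iter n x y)
    (hx : ∀ j < n, f.toFun^[j] x ≠ f.c) : f.toFun^[n] x = y := by
  simpa [iter_zero] using h.drop le_rfl hx

/-- A path is deterministic up to its first visit to `c`. If that visit happens before the end, the
endpoint lies on the orbit of `c`. -/
theorem Iter.cases {n : ℕ} {x y : ℝ} (h : f.Iter n x y) :
    ((∀ j < n, f.toFun^[j] x ≠ f.c) ∧ f.toFun^[n] x = y) ∨
      ∃ j < n, (∀ i < j, f.toFun^[i] x ≠ f.c) ∧ f.toFun^[j] x = f.c ∧ f.Iter (n - j) f.c y := by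
  classical
  by_cases hx : ∀ j < n, f.toFun^[j] x ≠ f.c
  · exact Or.inl ⟨hx, h.eq_of_avoids hx⟩
  · push Not at hx
    have hmin : ∀ i < Nat.find hx, f.toFun^[i] x ≠ f.c := fun i hi e =>
      Nat.find_min hx hi ⟨hi.trans (Nat.find_spec hx).1, e⟩
    obtain ⟨h₁, h₂⟩ := Nat.find_spec hx
    have h₃ := h.drop h₁.le hmin
    rw [h₂] at h₃
    exact Or.inr ⟨_, h₁, hmin, h₂, h₃⟩

theorem Iter.exists_hit {n : ℕ} {x : ℝ} (h : f.Iter n x f.c) :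
    ∃ j, f.toFun^[j] x = f.c ∧ ∀ i < j, f.toFun^[i] x ≠ f.c := by
  rcases h.cases with h | ⟨j, -, h₁, h₂, -⟩
  · exact ⟨n, h.2, h.1⟩
  · exact ⟨j, h₂, h₁⟩

theorem Iter.reflect {n : ℕ} {x y : ℝ} (h : f.Iter n x y) : f.reflect.Iter n (-x) (-y) := by
  induction n generalizing x with
  | zero => exact congrArg Neg.neg (show x = y from h)
  | succ n ih =>
    obtain ⟨z, hz, hzy⟩ := h
    refine ⟨-z, ?_, ih hzy⟩
    rw [step_iff] at hz ⊢
    rw [mem_dom_reflect, neg_neg, reflect_plus, reflect_minus, neg_neg, neg_inj, neg_inj]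
    exact ⟨hz.1, hz.2.symm⟩

theorem iter_reflect {n : ℕ} {x y : ℝ} : f.reflect.Iter n x y ↔ f.Iter n (-x) (-y) := by
  constructor
  · intro h; simpa using h.reflect
  · intro h; simpa using h.reflect

theorem orb_subset_dom {S : Set ℝ} (hS : S ⊆ f.dom) : f.orb S ⊆ f.dom := by
  rintro y ⟨x, hx, n, hn⟩
  exact hn.mem_dom (hS hx)

theorem Iter.mem_orb {S : Set ℝ} {n : ℕ} {x y : ℝ} (h : f.Iter n x y) (hx : x ∈ f.orb S) :
    y ∈ f.orb S := by
  obtain ⟨w, hw, m, hm⟩ := hx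
  exact ⟨w, hw, m + n, hm.trans h⟩

theorem subset_orb {S : Set ℝ} : S ⊆ f.orb S := fun x hx => ⟨x, hx, 0, rfl⟩

/-! ### Expanding maps -/

theorem IsExpanding.exists_hit (hf : f.IsExpanding) {p q : ℝ} (hp : f.a ≤ p) (hpq : p < q)
    (hq : q ≤ f.b) : ∃ y ∈ Ioo p q, ∃ n, f.toFun^[n] y = f.c ∧ ∀ i < n, f.toFun^[i] y ≠ f.c := by
  obtain ⟨z, hz⟩ := exists_between hpq
  obtain ⟨y, hy, hy'⟩ := mem_closure_iff.1 (hf ⟨hp.trans hz.1.le, hz.2.le.trans hq⟩) _ isOpen_Ioo hz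
  obtain ⟨n, hn⟩ := mem_iUnion.1 hy'
  exact ⟨y, hy, hn.2.exists_hit⟩

theorem isExpanding_of_hits (H : ∀ p q, f.a ≤ p → p < q → q ≤ f.b →
    ∃ y ∈ Ioo p q, ∃ n, f.Iter n y f.c) : f.IsExpanding := by
  have h₁ : Ioo f.a f.b ⊆ closure (⋃ n : ℕ, f.preimages n f.c) := by
    intro z hz
    rw [Metric.mem_closure_iff]
    intro ε hε
    obtain ⟨y, hy, n, hn⟩ := H (max f.a (z - ε)) (min f.b (z + ε)) (le_max_left _ _)
      (by simp only [max_lt_iff, lt_min_iff]; exact ⟨⟨f.a_lt_b, by linarith [hz.2]⟩,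
        by linarith [hz.1], by linarith⟩) (min_le_left _ _)
    simp only [mem_Ioo, max_lt_iff, lt_min_iff] at hy
    refine ⟨y, mem_iUnion.2 ⟨n, ⟨hy.1.1.le, hy.2.1.le⟩, hn⟩, ?_⟩
    rw [dist_comm, Real.dist_eq, abs_lt]
    constructor <;> linarith [hy.1.2, hy.2.2]
  have h₂ := closure_minimal h₁ isClosed_closure
  rwa [closure_Ioo f.a_lt_b.ne] at h₂

theorem IsExpanding.reflect (hf : f.IsExpanding) : f.reflect.IsExpanding := by
  refine isExpanding_of_hits fun p q hp hpq hq => ?_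
  obtain ⟨y, hy, n, hn, hn'⟩ := hf.exists_hit (p := -q) (q := -p)
    (by simp only [reflect_b] at hq; linarith) (neg_lt_neg hpq)
    (by simp only [reflect_a] at hp; linarith)
  refine ⟨-y, ⟨by linarith [hy.2], by linarith [hy.1]⟩, n, iter_reflect.2 ?_⟩
  simp only [reflect_a, reflect_b] at hp hq
  simp only [neg_neg, reflect_c]
  exact hn ▸ iter_toFun ⟨by linarith [hy.1], by linarith [hy.2]⟩ hn'

/-- An expanding map has no intervals that return to themselves without visiting `c`. -/
theorem IsExpanding.no_avoid (hf : f.IsExpanding) {p q : ℝ} (hp : f.a ≤ p) (hpq : p < q)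
    (hq : q ≤ f.b) {n : ℕ} (hn : 0 < n) {S : Set ℝ} (hS : Ioo p q ⊆ S) (h : f.Avoids n S)
    (hm : MapsTo f.toFun^[n] S S) : False := by
  have key : ∀ N, ∀ y ∈ S, f.toFun^[N] y ≠ f.c := by
    intro N
    induction N using Nat.strong_induction_on with
    | _ N ih =>
      intro y hy
      rcases lt_or_ge N n with hN | hN
      · exact h y hy N hN
      · have := ih (N - n) (by lia) _ (hm hy)
        rwa [← Function.iterate_add_apply, Nat.sub_add_cancel hN] at this
  obtain ⟨y, hy, N, hN, -⟩ := hf.exists_hit hp hpq hq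
  exact key N y (hS hy) hN

/-- If no image ever contained `c`, the whole interval would avoid `c` forever, against the density
of its preimages. This is the form in which expansion is used most. -/
theorem IsExpanding.exists_first (hf : f.IsExpanding) {p q : ℝ} (hp : f.a ≤ p) (hpq : p < q)
    (hq : q ≤ f.b) :
    ∃ n, f.Avoids n (Ioo p q) ∧ f.c ∈ Ioo (f.plus^[n] p) (f.minus^[n] q) := by
  by_contra! H
  have : ∀ n, f.Avoids n (Ioo p q) := by
    intro n
    induction n with
    | zero => intro x _ j hj; lia
    | succ n ih => exact ih.succ_Ioo hp hpq hq (H n ih)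
  obtain ⟨y, hy, N, hN, -⟩ := hf.exists_hit hp hpq hq
  exact this (N + 1) y hy N (by lia) hN

/-- Otherwise `f` would be injective and would miss the interval `(f(b), f(a))`. Two points of that
interval whose orbits reach `c` could be pulled back along the common end of their orbits, so they
would coincide or one would be an image of the other; neither is possible. The inequality makes
every point have a preimage. -/
theorem IsExpanding.toFun_a_le (hf : f.IsExpanding) : f.toFun f.a ≤ f.toFun f.b := by
  by_contra! hlt
  have haI : f.a ∈ Ico f.a f.c := ⟨le_rfl, f.a_lt_c⟩
  have hbI : f.b ∈ Ioc f.c f.b := ⟨f.c_lt_b, le_rfl⟩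
  have hleft : ∀ z ∈ Ico f.a f.c, f.toFun f.a ≤ f.toFun z := fun z hz =>
    f.strictMonoOn_left.monotoneOn haI hz hz.1
  have hright : ∀ z ∈ Ioc f.c f.b, f.toFun z ≤ f.toFun f.b := fun z hz =>
    f.strictMonoOn_right.monotoneOn hz hbI hz.2
  have hside : ∀ z ∈ f.dom, z ≠ f.c → z ∈ Ico f.a f.c ∨ z ∈ Ioc f.c f.b := fun z hz hzc =>
    (lt_or_gt_of_ne hzc).imp (fun h => ⟨hz.1, h⟩) fun h => ⟨h, hz.2⟩
  have hinj : ∀ z ∈ f.dom, ∀ w ∈ f.dom, z ≠ f.c → w ≠ f.c → f.toFun z = f.toFun w → z = w := by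
    intro z hz w hw hzc hwc e
    rcases hside z hz hzc with h₁ | h₁ <;> rcases hside w hw hwc with h₂ | h₂
    · exact f.strictMonoOn_left.injOn h₁ h₂ e
    · linarith [hleft z h₁, hright w h₂]
    · linarith [hleft w h₂, hright z h₁]
    · exact f.strictMonoOn_right.injOn h₁ h₂ e
  have hgap : ∀ z ∈ f.dom, z ≠ f.c → f.toFun z ∉ Ioo (f.toFun f.b) (f.toFun f.a) := by
    intro z hz hzc hm
    rcases hside z hz hzc with h₁ | h₁
    · exact absurd hm.2 (hleft z h₁).not_gt
    · exact absurd hm.1 (hright z h₁).not_gt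
  have hback : ∀ n m : ℕ, ∀ y ∈ f.dom, ∀ y' ∈ f.dom, (∀ i < n, f.toFun^[i] y ≠ f.c) →
      (∀ i < m + n, f.toFun^[i] y' ≠ f.c) → f.toFun^[n] y = f.toFun^[m + n] y' →
      y = f.toFun^[m] y' := by
    intro n m y hy y' hy' h₁ h₂ e
    induction n with
    | zero => exact e
    | succ n ih =>
      rw [← Nat.add_assoc, Function.iterate_succ_apply', Function.iterate_succ_apply'] at e
      exact ih (fun i hi => h₁ i (by lia)) (fun i hi => h₂ i (by lia))
        (hinj _ (toFun_iterate_mem_dom hy fun i hi => h₁ i (by lia)) _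
          (toFun_iterate_mem_dom hy' fun i hi => h₂ i (by lia)) (h₁ n (by lia))
          (h₂ (m + n) (by lia)) e)
  have hcontra : ∀ n m : ℕ, ∀ y ∈ Ioo (f.toFun f.b) (f.toFun f.a), ∀ y' ∈ f.dom, y ∈ f.dom →
      y ≠ y' → (∀ i < n, f.toFun^[i] y ≠ f.c) →
      (∀ i < m + n, f.toFun^[i] y' ≠ f.c) → f.toFun^[n] y = f.toFun^[m + n] y' → False := by
    intro n m y hyG y' hy' hy hne h₁ h₂ e
    have e' := hback n m y hy y' hy' h₁ h₂ e
    rcases m with _ | m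
    · exact hne e'
    · rw [Function.iterate_succ_apply'] at e'
      exact hgap _ (toFun_iterate_mem_dom hy' fun i hi => h₂ i (by lia)) (h₂ m (by lia)) (e' ▸ hyG)
  have hfa := (f.mapsTo f.a f.a_mem_dom f.a_lt_c.ne)
  have hfb := (f.mapsTo f.b f.b_mem_dom f.c_lt_b.ne')
  obtain ⟨y, hy, n, hn, hn'⟩ := hf.exists_hit hfb.1 hlt hfa.2
  obtain ⟨y', hy', n', hm, hm'⟩ := hf.exists_hit hfb.1 hy.1 (hy.2.le.trans hfa.2)
  have hyd : y ∈ f.dom := ⟨hfb.1.trans hy.1.le, hy.2.le.trans hfa.2⟩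
  have hyd' : y' ∈ f.dom := ⟨hfb.1.trans hy'.1.le, hy'.2.le.trans hyd.2⟩
  rcases le_total n n' with hnn | hnn
  · obtain ⟨m, rfl⟩ := Nat.exists_eq_add_of_le' hnn
    exact hcontra n m y hy y' hyd' hyd hy'.2.ne' hn' hm' (hn.trans hm.symm)
  · obtain ⟨m, rfl⟩ := Nat.exists_eq_add_of_le' hnn
    exact hcontra n' m y' ⟨hy'.1, hy'.2.trans hy.2⟩ y hyd hyd' hy'.2.ne hm' hn' (hm.trans hn.symm)

theorem IsExpanding.exists_step (hf : f.IsExpanding) {x : ℝ} (hx : x ∈ f.dom) :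
    ∃ y ∈ f.dom, f.Step y x := by
  rcases eq_or_lt_of_le hx.1 with rfl | hax
  · exact ⟨f.c, c_mem_dom, c_mem_dom, Or.inr ⟨rfl, Or.inl rfl⟩⟩
  rcases eq_or_lt_of_le hx.2 with rfl | hxb
  · exact ⟨f.c, c_mem_dom, c_mem_dom, Or.inr ⟨rfl, Or.inr rfl⟩⟩
  rcases lt_trichotomy x (f.toFun f.a) with h | h | h
  · obtain ⟨-, h₂⟩ := f.image_Ioo (p := f.c) (q := f.b) f.a_lt_c.le f.c_lt_b le_rfl (by simp)
    have : x ∈ f.toFun '' Ioo f.c f.b := by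
      rw [h₂, plus_c, minus_of_ne f.c_lt_b.ne']; exact ⟨hax, h.trans_le hf.toFun_a_le⟩
    obtain ⟨y, hy, rfl⟩ := this
    have hyd : y ∈ f.dom := ⟨f.a_lt_c.le.trans hy.1.le, hy.2.le⟩
    exact ⟨y, hyd, hyd, Or.inl ⟨hy.1.ne', rfl⟩⟩
  · exact ⟨f.a, a_mem_dom, a_mem_dom, Or.inl ⟨f.a_lt_c.ne, h⟩⟩
  · obtain ⟨-, h₂⟩ := f.image_Ioo (p := f.a) (q := f.c) le_rfl f.a_lt_c f.c_lt_b.le (by simp)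
    have : x ∈ f.toFun '' Ioo f.a f.c := by
      rw [h₂, minus_c, plus_of_ne f.a_lt_c.ne]; exact ⟨h, hxb⟩
    obtain ⟨y, hy, rfl⟩ := this
    have hyd : y ∈ f.dom := ⟨hy.1.le, hy.2.le.trans f.c_lt_b.le⟩
    exact ⟨y, hyd, hyd, Or.inl ⟨hy.2.ne, rfl⟩⟩

theorem IsExpanding.exists_iter (hf : f.IsExpanding) {x : ℝ} (hx : x ∈ f.dom) (n : ℕ) :
    ∃ y ∈ f.dom, f.Iter n y x := by
  induction n generalizing x with
  | zero => exact ⟨x, hx, rfl⟩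
  | succ n ih =>
    obtain ⟨y, hy, hyx⟩ := hf.exists_step hx
    obtain ⟨z, hz, hzy⟩ := ih hy
    exact ⟨z, hz, hzy.trans (iter_one.2 hyx)⟩

/-! ### Limit sets -/

theorem mem_alpha {x z : ℝ} : z ∈ f.alpha x ↔
    ∀ n : ℕ, ∀ ε > 0, ∃ k ≥ n, ∃ y ∈ f.dom, f.Iter k y x ∧ |y - z| < ε := by
  simp only [alpha, mem_iInter, Metric.mem_closure_iff, mem_iUnion, preimages, mem_ofPred_eq,
    dist_comm z, Real.dist_eq]
  refine forall_congr' fun n => forall_congr' fun ε => imp_congr_right fun _ => ?_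
  constructor
  · rintro ⟨y, ⟨k, hk, hy, hyx⟩, hyz⟩
    exact ⟨k, hk, y, hy, hyx, hyz⟩
  · rintro ⟨k, hk, y, hy, hyx, hyz⟩
    exact ⟨y, ⟨k, hk, hy, hyx⟩, hyz⟩

theorem isClosed_alpha (x : ℝ) : IsClosed (f.alpha x) := isClosed_iInter fun _ => isClosed_closure

theorem alpha_subset_dom (x : ℝ) : f.alpha x ⊆ f.dom := by
  intro z hz
  exact closure_minimal (iUnion_subset fun _ => iUnion_subset fun _ _ hy => hy.1) isClosed_Icc
    (mem_iInter.1 hz 0)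

theorem IsExpanding.alpha_nonempty (hf : f.IsExpanding) {x : ℝ} (hx : x ∈ f.dom) :
    (f.alpha x).Nonempty := by
  refine IsCompact.nonempty_iInter_of_sequence_nonempty_isCompact_isClosed _ ?_ ?_ ?_ ?_
  · intro n
    exact closure_mono (iUnion_mono fun k => iUnion_subset fun hk => subset_iUnion_of_subset
      (by lia) Subset.rfl)
  · intro n
    obtain ⟨y, hy, hyx⟩ := hf.exists_iter hx n
    exact ⟨y, subset_closure (mem_iUnion₂.2 ⟨n, le_rfl, hy, hyx⟩)⟩
  · refine isCompact_Icc.of_isClosed_subset isClosed_closure (closure_minimal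
      (iUnion_subset fun _ => iUnion_subset fun _ _ hy => hy.1) isClosed_Icc)
  · exact fun n => isClosed_closure

/-- Deep preimages of `y` are even deeper preimages of its image `x`. -/
theorem Iter.alpha_subset {n : ℕ} {x y : ℝ} (h : f.Iter n y x) : f.alpha y ⊆ f.alpha x := by
  intro z hz
  rw [mem_alpha] at hz ⊢
  intro N ε hε
  obtain ⟨k, hk, w, hw, hwy, hwz⟩ := hz N ε hε
  exact ⟨k + n, by lia, w, hw, hwy.trans h, hwz⟩

theorem alpha_reflect {x z : ℝ} : z ∈ f.reflect.alpha x ↔ -z ∈ f.alpha (-x) := by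
  simp only [mem_alpha]
  refine forall_congr' fun n => forall_congr' fun ε => imp_congr_right fun _ =>
    exists_congr fun k => and_congr_right fun _ => ?_
  constructor
  · rintro ⟨y, hy, hyx, hyz⟩
    refine ⟨-y, mem_dom_reflect.1 hy, iter_reflect.1 hyx, ?_⟩
    rwa [← abs_neg, show -(-y - -z) = y - z by ring]
  · rintro ⟨y, hy, hyx, hyz⟩
    refine ⟨-y, mem_dom_reflect.2 (by simpa using hy), iter_reflect.2 (by simpa using hyx), ?_⟩
    rwa [← abs_neg, show -(-y - z) = y - -z by ring]

theorem exists_mem_of_mem_alpha {x z p q : ℝ} (hz : z ∈ f.alpha x) (hpq : z ∈ Ioo p q) (N : ℕ) :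
    ∃ k ≥ N, ∃ y ∈ Ioo p q, y ∈ f.dom ∧ f.Iter k y x := by
  obtain ⟨k, hk, y, hy, hyx, hyz⟩ := mem_alpha.1 hz N (min (z - p) (q - z))
    (lt_min (by linarith [hpq.1]) (by linarith [hpq.2]))
  rw [lt_min_iff, abs_lt, abs_lt] at hyz
  exact ⟨k, hk, y, ⟨by linarith [hyz.1.1], by linarith [hyz.2.2]⟩, hy, hyx⟩

theorem mem_alpha_of_Ioo {x z : ℝ} (hz : z ∈ Ioo f.a f.b) (H : ∀ p q, f.a ≤ p → q ≤ f.b →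
    z ∈ Ioo p q → ∀ N, ∃ k ≥ N, ∃ y ∈ Ioo p q, f.Iter k y x) : z ∈ f.alpha x := by
  rw [mem_alpha]
  intro N ε hε
  obtain ⟨k, hk, y, hy, hyx⟩ := H (max f.a (z - ε)) (min f.b (z + ε)) (le_max_left _ _)
    (min_le_left _ _) ⟨max_lt hz.1 (by linarith), lt_min hz.2 (by linarith)⟩ N
  simp only [mem_Ioo, max_lt_iff, lt_min_iff] at hy
  refine ⟨k, hk, y, ⟨hy.1.1.le, hy.2.1.le⟩, hyx, ?_⟩
  rw [abs_lt]
  constructor <;> linarith [hy.1.2, hy.2.2]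

/-- Deep preimages can be pulled back along a branch. -/
theorem Avoids.exists_of_mem_alpha {p q : ℝ} (hp : f.a ≤ p) (hpq : p < q) (hq : q ≤ f.b) {n : ℕ}
    (h : f.Avoids n (Ioo p q)) {x z : ℝ} (hz : z ∈ f.alpha x)
    (hz' : z ∈ Ioo (f.plus^[n] p) (f.minus^[n] q)) (N : ℕ) :
    ∃ k ≥ N, ∃ y ∈ Ioo p q, f.Iter k y x := by
  obtain ⟨k, hk, y, hy, -, hyx⟩ := exists_mem_of_mem_alpha hz hz' N
  rw [← (h.image_Ioo hp hpq hq).2] at hy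
  obtain ⟨w, hw, rfl⟩ := hy
  exact ⟨n + k, by lia, w, hw,
    (iter_toFun ⟨hp.trans hw.1.le, hw.2.le.trans hq⟩ (h w hw)).trans hyx⟩

theorem IsExpanding.alpha_eq_dom (hf : f.IsExpanding) {x : ℝ} (hc : f.c ∈ f.alpha x) :
    f.alpha x = f.dom := by
  refine (alpha_subset_dom x).antisymm ?_
  have : Ioo f.a f.b ⊆ f.alpha x := by
    intro z hz
    refine mem_alpha_of_Ioo hz fun p q hp hq hzpq N => ?_
    obtain ⟨n, hn, hcn⟩ := hf.exists_first hp (hzpq.1.trans hzpq.2) hq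
    exact hn.exists_of_mem_alpha hp (hzpq.1.trans hzpq.2) hq hc hcn N
  have h₂ := closure_minimal this (isClosed_alpha x)
  rwa [closure_Ioo f.a_lt_b.ne] at h₂

/-- Right neighbourhoods of `c` are mapped onto punctured right neighbourhoods of `a`, and `a`
itself is an image of `c`. -/
theorem c_mem_alpha_of_a_mem {x : ℝ} (ha : f.a ∈ f.alpha x) : f.c ∈ f.alpha x := by
  refine mem_alpha_of_Ioo ⟨f.a_lt_c, f.c_lt_b⟩ fun p q hp hq hc N => ?_
  obtain ⟨h₁, h₂⟩ := f.image_Ioo (p := f.c) (q := q) f.a_lt_c.le hc.2 hq (by simp)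
  rw [plus_c] at h₁ h₂
  obtain ⟨k, hk, y, hy, hyd, hyx⟩ := exists_mem_of_mem_alpha ha
    (p := f.a - 1) (q := f.minus q) ⟨by linarith, h₁⟩ N
  rcases eq_or_lt_of_le hyd.1 with rfl | hay
  · exact ⟨1 + k, by lia, f.c, hc,
      (iter_one.2 ⟨c_mem_dom, Or.inr ⟨rfl, Or.inl rfl⟩⟩).trans hyx⟩
  · have : y ∈ f.toFun '' Ioo f.c q := h₂ ▸ ⟨hay, hy.2⟩
    obtain ⟨w, hw, rfl⟩ := this
    exact ⟨1 + k, by lia, w, ⟨hc.1.trans hw.1, hw.2⟩, (iter_one.2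
      ⟨⟨f.a_lt_c.le.trans hw.1.le, hw.2.le.trans hq⟩, Or.inl ⟨hw.1.ne', rfl⟩⟩).trans hyx⟩

theorem c_mem_alpha_of_b_mem {x : ℝ} (hb : f.b ∈ f.alpha x) : f.c ∈ f.alpha x := by
  have := c_mem_alpha_of_a_mem (f := f.reflect) (x := -x) (by rw [alpha_reflect]; simpa using hb)
  simpa [alpha_reflect] using this

/-! ### Invariant closed sets that miss the discontinuity. -/

/-- Closed sets that are invariant in the way proper limit sets are. -/
structure IsInvariant (f : LorenzMap) (E : Set ℝ) : Prop where
  isClosed : IsClosed E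
  nonempty : E.Nonempty
  subset : E ⊆ Ioo f.a f.b
  c_notMem : f.c ∉ E
  forward : ∀ z ∈ E, f.toFun z ∈ E
  backward : ∀ z ∈ Ioo f.a f.b, z ≠ f.c → f.toFun z ∈ E → z ∈ E

theorem backward_alpha {x z : ℝ} (hz : z ∈ Ioo f.a f.b) (hzc : z ≠ f.c)
    (hx : f.toFun z ∈ f.alpha x) : z ∈ f.alpha x := by
  refine mem_alpha_of_Ioo hz fun p q hp hq hzpq N => ?_
  -- The neighbourhood is cut at `c`, so that `f` maps it homeomorphically onto an interval around
  -- `f z`.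
  obtain ⟨p', q', hp', hq', hz', hc'⟩ : ∃ p' q', p ≤ p' ∧ q' ≤ q ∧ z ∈ Ioo p' q' ∧
      f.c ∉ Ioo p' q' := by
    rcases lt_or_gt_of_ne hzc with h | h
    · exact ⟨p, min q f.c, le_rfl, min_le_left _ _, ⟨hzpq.1, lt_min hzpq.2 h⟩,
        fun hc => absurd hc.2 (min_le_right _ _).not_gt⟩
    · exact ⟨max p f.c, q, le_max_left _ _, le_rfl, ⟨max_lt hzpq.1 h, hzpq.2⟩,
        fun hc => absurd hc.1 (le_max_right _ _).not_gt⟩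
  have hav : f.Avoids 1 (Ioo p' q') := by
    intro w hw j hj
    obtain rfl : j = 0 := by lia
    rintro rfl
    exact hc' hw
  have hpq' := hz'.1.trans hz'.2
  have him := hav.image_Ioo (hp.trans hp') hpq' (hq'.trans hq)
  obtain ⟨k, hk, y, hy, hyx⟩ := hav.exists_of_mem_alpha (hp.trans hp') hpq' (hq'.trans hq) hx
    (him.2 ▸ mem_image_of_mem _ hz') N
  exact ⟨k, hk, y, ⟨hp'.trans_lt hy.1, hy.2.trans_le hq'⟩, hyx⟩

theorem IsExpanding.isInvariant_alpha (hf : f.IsExpanding) {x : ℝ} (hx : x ∈ f.dom)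
    (hc : f.c ∉ f.alpha x) : f.IsInvariant (f.alpha x) := by
  have hsub : f.alpha x ⊆ Ioo f.a f.b := by
    intro z hz
    have hd := alpha_subset_dom x hz
    refine ⟨lt_of_le_of_ne hd.1 ?_, lt_of_le_of_ne hd.2 ?_⟩
    · rintro rfl; exact hc (c_mem_alpha_of_a_mem hz)
    · rintro rfl; exact hc (c_mem_alpha_of_b_mem hz)
  refine ⟨isClosed_alpha x, hf.alpha_nonempty hx, hsub, hc, ?_, fun z hz hzc h =>
    backward_alpha hz hzc h⟩
  intro z hz
  have hzc : z ≠ f.c := by rintro rfl; exact hc hz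
  obtain ⟨h₁, h₂⟩ := f.eventually_avoids (hsub hz) (n := 1) (by
    intro j hj; obtain rfl : j = 0 := by lia
    exact hzc)
  rw [mem_alpha]
  intro N ε hε
  have h₃ : ∀ᶠ w in 𝓝 z, |f.toFun w - f.toFun z| < ε := by
    have := Metric.tendsto_nhds.1 h₁ ε hε
    simpa [Real.dist_eq] using this
  obtain ⟨δ, hδ, hball⟩ := Metric.eventually_nhds_iff.1 (h₂.and h₃)
  -- Depth `N + 1` is needed because passing from `y` to `f y` costs one step.
  obtain ⟨k, hk, y, hy, hyx, hyz⟩ := mem_alpha.1 hz (N + 1) δ hδ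
  obtain ⟨h₄, h₅⟩ := hball (y := y) (by rwa [Real.dist_eq])
  refine ⟨k - 1, by lia, f.toFun y, f.mapsTo y hy (h₄ 0 (by lia)), hyx.drop (by lia) h₄, h₅⟩

namespace IsInvariant
variable {E : Set ℝ}

theorem reflect (hE : f.IsInvariant E) : f.reflect.IsInvariant (Neg.neg ⁻¹' E) where
  isClosed := hE.isClosed.preimage continuous_neg
  nonempty := by
    obtain ⟨x, hx⟩ := hE.nonempty
    exact ⟨-x, by simpa using hx⟩
  subset x hx := by
    have := hE.subset hx
    exact ⟨by simp only [reflect_a]; linarith [this.2], by simp only [reflect_b]; linarith [this.1]⟩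
  c_notMem := by simpa using hE.c_notMem
  forward z hz := by
    simp only [mem_preimage, reflect_toFun, neg_neg]
    exact hE.forward _ hz
  backward z hz hzc h := by
    simp only [mem_preimage, reflect_toFun, neg_neg] at h ⊢
    simp only [reflect_a, reflect_b] at hz
    exact hE.backward _ ⟨by linarith [hz.2], by linarith [hz.1]⟩
      (fun e => hzc (by rw [reflect_c, ← e, neg_neg])) h

theorem iterate_mem (hE : f.IsInvariant E) {z : ℝ} (hz : z ∈ E) (n : ℕ) : f.toFun^[n] z ∈ E := by
  induction n with
  | zero => exact hz
  | succ n ih => rw [Function.iterate_succ_apply']; exact hE.forward _ ih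

theorem ne_c (hE : f.IsInvariant E) {z : ℝ} (hz : z ∈ E) : z ≠ f.c := by
  rintro rfl; exact hE.c_notMem hz

theorem iterate_ne_c (hE : f.IsInvariant E) {z : ℝ} (hz : z ∈ E) (n : ℕ) : f.toFun^[n] z ≠ f.c :=
  hE.ne_c (hE.iterate_mem hz n)

theorem mem_of_iterate_mem (hE : f.IsInvariant E) {z : ℝ} (hz : z ∈ Ioo f.a f.b) {n : ℕ}
    (hn : ∀ j < n, f.toFun^[j] z ≠ f.c) (h : f.toFun^[n] z ∈ E) : z ∈ E := by
  induction n with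
  | zero => exact h
  | succ n ih =>
    rw [Function.iterate_succ_apply'] at h
    exact ih (fun j hj => hn j (by lia)) (hE.backward _
      (toFun_iterate_mem_Ioo hz fun j hj => hn j (by lia)) (hn n (by lia)) h)

theorem mem_dom (hE : f.IsInvariant E) {z : ℝ} (hz : z ∈ E) : z ∈ f.dom :=
  Ioo_subset_dom (hE.subset hz)

end IsInvariant
end LorenzMap

/-! ### First return maps. -/

namespace LorenzMap
variable {f g h : LorenzMap}

theorem avoids_reflect {n : ℕ} {S : Set ℝ} :
    f.reflect.Avoids n S ↔ f.Avoids n (Neg.neg ⁻¹' S) := by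
  constructor
  · intro h x hx j hj e
    exact h (-x) hx j hj (by rw [reflect_iterate, neg_neg, e, reflect_c])
  · intro h x hx j hj e
    rw [reflect_iterate, reflect_c, neg_inj] at e
    exact h (-x) (by simpa using hx) j hj e

theorem plus_iterate_eq' {x : ℝ} {n : ℕ} (hn : ∀ j < n, f.plus^[j] x ≠ f.c) :
    f.plus^[n] x = f.toFun^[n] x := by
  induction n with
  | zero => rfl
  | succ n ih => rw [Function.iterate_succ_apply', Function.iterate_succ_apply',
      plus_of_ne (hn n (by lia)), ih fun j hj => hn j (by lia)]

theorem minus_iterate_eq' {x : ℝ} {n : ℕ} (hn : ∀ j < n, f.minus^[j] x ≠ f.c) :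
    f.minus^[n] x = f.toFun^[n] x := by
  induction n with
  | zero => rfl
  | succ n ih => rw [Function.iterate_succ_apply', Function.iterate_succ_apply',
      minus_of_ne (hn n (by lia)), ih fun j hj => hn j (by lia)]

/-- Both sides are the right-hand limit of `g` at `c`. -/
theorem plus_iterate_c_of {R : ℕ} (hc : g.c = f.c) (hb : g.b ≤ f.b)
    (hav : f.Avoids R (Ioc f.c g.b)) (heq : ∀ x ∈ Ioc f.c g.b, g.toFun x = f.toFun^[R] x) :
    f.plus^[R] f.c = g.a := by
  have hcb : f.c < g.b := hc ▸ g.c_lt_b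
  have h₁ := (hav.mono Ioo_subset_Ioc_self le_rfl).tendsto f.a_lt_c.le hcb hb
  have h₂ := g.tendsto_right
  rw [hc] at h₂
  refine tendsto_nhds_unique h₁.1 (h₂.congr' ?_)
  filter_upwards [Ioo_mem_nhdsGT hcb] with x hx
  exact heq x ⟨hx.1, hx.2.le⟩

theorem minus_iterate_c_of {L : ℕ} (hc : g.c = f.c) (ha : f.a ≤ g.a)
    (hav : f.Avoids L (Ico g.a f.c)) (heq : ∀ x ∈ Ico g.a f.c, g.toFun x = f.toFun^[L] x) :
    f.minus^[L] f.c = g.b := by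
  have hac : g.a < f.c := hc ▸ g.a_lt_c
  have h₁ := (hav.mono Ioo_subset_Ico_self le_rfl).tendsto ha hac f.c_lt_b.le
  have h₂ := g.tendsto_left
  rw [hc] at h₂
  refine tendsto_nhds_unique h₁.2 (h₂.congr' ?_)
  filter_upwards [Ioo_mem_nhdsLT hac] with x hx
  exact heq x ⟨hx.1.le, hx.2⟩

/-- `g` is the first return map `(f^L, f^R)` of `f` to the interior of its domain. -/
structure IsReturn (f g : LorenzMap) (L R : ℕ) : Prop where
  c_eq : g.c = f.c
  left_pos : 0 < L
  right_pos : 0 < R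
  dom_subset : g.dom ⊆ f.dom
  avoids_left : f.Avoids L (Ico g.a f.c)
  avoids_right : f.Avoids R (Ioc f.c g.b)
  eq_left : ∀ x ∈ Ico g.a f.c, g.toFun x = f.toFun^[L] x
  eq_right : ∀ x ∈ Ioc f.c g.b, g.toFun x = f.toFun^[R] x
  no_return_left : ∀ x ∈ Ico g.a f.c, ∀ j, 0 < j → j < L → f.toFun^[j] x ∉ Ioo g.a g.b
  no_return_right : ∀ x ∈ Ioc f.c g.b, ∀ j, 0 < j → j < R → f.toFun^[j] x ∉ Ioo g.a g.b

theorem isReturn_self (f : LorenzMap) : f.IsReturn f 1 1 where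
  c_eq := rfl
  left_pos := one_pos
  right_pos := one_pos
  dom_subset := Subset.rfl
  avoids_left x hx j hj := by obtain rfl : j = 0 := by lia
                              exact hx.2.ne
  avoids_right x hx j hj := by obtain rfl : j = 0 := by lia
                               exact hx.1.ne'
  eq_left _ _ := rfl
  eq_right _ _ := rfl
  no_return_left _ _ j h₁ h₂ := by lia
  no_return_right _ _ j h₁ h₂ := by lia

namespace IsReturn
variable {L R : ℕ}

theorem reflect (hg : f.IsReturn g L R) : f.reflect.IsReturn g.reflect R L where
  c_eq := congrArg Neg.neg hg.c_eq
  left_pos := hg.right_pos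
  right_pos := hg.left_pos
  dom_subset x hx := mem_dom_reflect.2 (hg.dom_subset (mem_dom_reflect.1 hx))
  avoids_left := avoids_reflect.2 (hg.avoids_right.mono (fun x hx => by
    simp only [mem_preimage, reflect_a, reflect_c, mem_Ico] at hx
    exact ⟨by linarith [hx.2], by linarith [hx.1]⟩) le_rfl)
  avoids_right := avoids_reflect.2 (hg.avoids_left.mono (fun x hx => by
    simp only [mem_preimage, reflect_b, reflect_c, mem_Ioc] at hx
    exact ⟨by linarith [hx.2], by linarith [hx.1]⟩) le_rfl)
  eq_left x hx := by
    simp only [reflect_a, reflect_c, mem_Ico] at hx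
    rw [reflect_toFun, reflect_iterate, hg.eq_right _ ⟨by linarith [hx.2], by linarith [hx.1]⟩]
  eq_right x hx := by
    simp only [reflect_b, reflect_c, mem_Ioc] at hx
    rw [reflect_toFun, reflect_iterate, hg.eq_left _ ⟨by linarith [hx.2], by linarith [hx.1]⟩]
  no_return_left x hx j h₁ h₂ h := by
    simp only [reflect_a, reflect_c, mem_Ico] at hx
    simp only [reflect_a, reflect_b, reflect_iterate, mem_Ioo] at h
    exact hg.no_return_right (-x) ⟨by linarith [hx.2], by linarith [hx.1]⟩ j h₁ h₂
      ⟨by linarith [h.2], by linarith [h.1]⟩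
  no_return_right x hx j h₁ h₂ h := by
    simp only [reflect_b, reflect_c, mem_Ioc] at hx
    simp only [reflect_a, reflect_b, reflect_iterate, mem_Ioo] at h
    exact hg.no_return_left (-x) ⟨by linarith [hx.2], by linarith [hx.1]⟩ j h₁ h₂
      ⟨by linarith [h.2], by linarith [h.1]⟩

theorem a_lt_c (hg : f.IsReturn g L R) : g.a < f.c := hg.c_eq ▸ g.a_lt_c
theorem c_lt_b (hg : f.IsReturn g L R) : f.c < g.b := hg.c_eq ▸ g.c_lt_b
theorem c_mem (hg : f.IsReturn g L R) : f.c ∈ g.dom := ⟨hg.a_lt_c.le, hg.c_lt_b.le⟩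
theorem c_mem_Ioo (hg : f.IsReturn g L R) : f.c ∈ Ioo g.a g.b := ⟨hg.a_lt_c, hg.c_lt_b⟩
theorem a_le (hg : f.IsReturn g L R) : f.a ≤ g.a := (hg.dom_subset g.a_mem_dom).1
theorem le_b (hg : f.IsReturn g L R) : g.b ≤ f.b := (hg.dom_subset g.b_mem_dom).2

theorem plus_iterate_c (hg : f.IsReturn g L R) : f.plus^[R] f.c = g.a :=
  plus_iterate_c_of hg.c_eq hg.le_b hg.avoids_right hg.eq_right

theorem minus_iterate_c (hg : f.IsReturn g L R) : f.minus^[L] f.c = g.b :=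
  minus_iterate_c_of hg.c_eq hg.a_le hg.avoids_left hg.eq_left

theorem plus_no_return (hg : f.IsReturn g L R) {j : ℕ} (h₀ : 0 < j) (hj : j < R) :
    f.plus^[j] f.c ∉ Ioo g.a g.b := by
  intro hmem
  have h₁ := (hg.avoids_right.mono Ioo_subset_Ioc_self hj.le).tendsto f.a_lt_c.le hg.c_lt_b hg.le_b
  obtain ⟨x, hx, hx'⟩ := ((h₁.1.eventually (Ioo_mem_nhds hmem.1 hmem.2)).and
    (eventually_mem_set.2 (Ioo_mem_nhdsGT hg.c_lt_b))).exists
  exact hg.no_return_right x ⟨hx'.1, hx'.2.le⟩ j h₀ hj hx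

theorem minus_no_return (hg : f.IsReturn g L R) {j : ℕ} (h₀ : 0 < j) (hj : j < L) :
    f.minus^[j] f.c ∉ Ioo g.a g.b := by
  intro hmem
  refine hg.reflect.plus_no_return h₀ hj ?_
  rw [reflect_plus_iterate, reflect_c, neg_neg]
  exact ⟨neg_lt_neg hmem.2, neg_lt_neg hmem.1⟩

theorem iter_of_step (hg : f.IsReturn g L R) {w z : ℝ} (h : g.Step w z) :
    ∃ n, 0 < n ∧ f.Iter n w z := by
  obtain ⟨hw, ⟨hwc, rfl⟩ | ⟨rfl, rfl | rfl⟩⟩ := h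
  · have hwd := hg.dom_subset hw
    rw [hg.c_eq] at hwc
    rcases lt_or_gt_of_ne hwc with h | h
    · have hw' : w ∈ Ico g.a f.c := ⟨hw.1, h⟩
      exact ⟨L, hg.left_pos, hg.eq_left w hw' ▸ iter_toFun hwd (hg.avoids_left w hw')⟩
    · have hw' : w ∈ Ioc f.c g.b := ⟨h, hw.2⟩
      exact ⟨R, hg.right_pos, hg.eq_right w hw' ▸ iter_toFun hwd (hg.avoids_right w hw')⟩
  · exact ⟨R, hg.right_pos, hg.c_eq ▸ hg.plus_iterate_c ▸ iter_plus c_mem_dom R⟩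
  · exact ⟨L, hg.left_pos, hg.c_eq ▸ hg.minus_iterate_c ▸ iter_minus c_mem_dom L⟩

theorem iter_of_iter (hg : f.IsReturn g L R) {k : ℕ} {w z : ℝ} (h : g.Iter k w z) :
    ∃ n ≥ k, f.Iter n w z := by
  induction k generalizing w with
  | zero => exact ⟨0, le_rfl, h⟩
  | succ k ih =>
    obtain ⟨y, hy, hyz⟩ := h
    obtain ⟨n, hn, hn'⟩ := hg.iter_of_step hy
    obtain ⟨m, hm, hm'⟩ := ih hyz
    exact ⟨n + m, by lia, hn'.trans hm'⟩

theorem orb_subset (hg : f.IsReturn g L R) {S : Set ℝ} : g.orb S ⊆ f.orb S := by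
  rintro y ⟨x, hx, n, hn⟩
  obtain ⟨m, -, hm⟩ := hg.iter_of_iter hn
  exact ⟨x, hx, m, hm⟩

theorem alpha_subset (hg : f.IsReturn g L R) (y : ℝ) : g.alpha y ⊆ f.alpha y := by
  intro z hz
  rw [mem_alpha] at hz ⊢
  intro N ε hε
  obtain ⟨k, hk, w, hw, hwy, hwz⟩ := hz N ε hε
  obtain ⟨n, hn, hn'⟩ := hg.iter_of_iter hwy
  exact ⟨n, by lia, w, hg.dom_subset hw, hn', hwz⟩

theorem step_toFun (hg : f.IsReturn g L R) {w : ℝ} (hw : w ∈ g.dom) (hwc : w ≠ f.c) :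
    g.Step w (g.toFun w) := ⟨hw, Or.inl ⟨hg.c_eq ▸ hwc, rfl⟩⟩

/-- One step of `g` is several steps of `f` that avoid `c`, so it shortens the time to the first
visit of `c`; strong induction on that time turns an `f`-visit into a `g`-visit. -/
theorem isExpanding (hg : f.IsReturn g L R) (hf : f.IsExpanding) : g.IsExpanding := by
  refine isExpanding_of_hits fun p q hp hpq hq => ?_
  obtain ⟨y, hy, n, hn, hn'⟩ := hf.exists_hit (hg.a_le.trans hp) hpq (hq.trans hg.le_b)
  refine ⟨y, hy, ?_⟩
  have hyd : y ∈ g.dom := ⟨hp.trans hy.1.le, hy.2.le.trans hq⟩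
  clear hy
  induction n using Nat.strong_induction_on generalizing y with
  | _ n ih =>
    have key : ∀ T, 0 < T → T ≤ n → y ≠ f.c → g.toFun y = f.toFun^[T] y → ∃ n, g.Iter n y g.c := by
      intro T h₀ hT hyc e
      have hst := hg.step_toFun hyd hyc
      obtain ⟨k, hk⟩ := ih (n - T) (by lia) (g.toFun y)
        (by rw [e, ← Function.iterate_add_apply, Nat.sub_add_cancel hT, hn])
        (fun i hi => by
          rw [e, ← Function.iterate_add_apply]; exact hn' _ (by lia)) hst.mem_dom
      exact ⟨k + 1, _, hst, hk⟩
    rcases lt_trichotomy y f.c with h | rfl | h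
    · have hy' : y ∈ Ico g.a f.c := ⟨hyd.1, h⟩
      exact key L hg.left_pos (not_lt.1 fun hL => hg.avoids_left y hy' n hL hn) h.ne
        (hg.eq_left y hy')
    · exact ⟨0, hg.c_eq.symm⟩
    · have hy' : y ∈ Ioc f.c g.b := ⟨h, hyd.2⟩
      exact key R hg.right_pos (not_lt.1 fun hL => hg.avoids_right y hy' n hL hn) h.ne'
        (hg.eq_right y hy')

/-- Every `f`-path starting in the domain of a first return map `g` is a `g`-path followed by a
short excursion. -/
theorem factor (hg : f.IsReturn g L R) {n : ℕ} {w z : ℝ} (h : f.Iter n w z) (hw : w ∈ g.dom) :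
    ∃ k w' j, g.Iter k w w' ∧ w' ∈ g.dom ∧ f.Iter j w' z ∧ j ≤ max L R ∧
      (j = 0 ∨ z ∉ Ioo g.a g.b) ∧ (w' ≠ f.c → ∀ i < j, f.toFun^[i] w' ≠ f.c) := by
  induction n using Nat.strong_induction_on generalizing w with
  | _ n ih =>
    have key : ∀ T, 0 < T → T ≤ max L R → (∀ j < T, f.toFun^[j] w ≠ f.c) →
        (∀ j, 0 < j → j < T → f.toFun^[j] w ∉ Ioo g.a g.b) → g.Step w (f.toFun^[T] w) →
        ∃ k w' j, g.Iter k w w' ∧ w' ∈ g.dom ∧ f.Iter j w' z ∧ j ≤ max L R ∧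
          (j = 0 ∨ z ∉ Ioo g.a g.b) ∧ (w' ≠ f.c → ∀ i < j, f.toFun^[i] w' ≠ f.c) := by
      intro T h₀ hT hav hret hst
      rcases lt_or_ge n T with hn | hn
      · refine ⟨0, w, n, rfl, hw, h, by lia, ?_, fun _ i hi => hav i (by lia)⟩
        rcases Nat.eq_zero_or_pos n with rfl | hpos
        · exact Or.inl rfl
        · right
          rw [← h.eq_of_avoids fun j hj => hav j (by lia)]
          exact hret n hpos hn
      · obtain ⟨k, w', j, h₁, h₂⟩ := ih (n - T) (by lia) (h.drop hn hav) hst.mem_dom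
        exact ⟨k + 1, w', j, ⟨_, hst, h₁⟩, h₂⟩
    -- From `c` the first step is a choice of `z₁ = a` or `z₁ = b`. The remaining `t = R - 1` or `t
    -- = L - 1` steps are deterministic, because a one-sided orbit of `c` does not meet `(g.a,
    -- g.b)`, which contains `c`, before it returns.
    have keyc : ∀ n' t z₁, n = n' + 1 → w = f.c → t + 1 ≤ max L R → f.Step w z₁ →
        (∀ j < t, f.toFun^[j] z₁ ≠ f.c) → (∀ j < t, f.toFun^[j] z₁ ∉ Ioo g.a g.b) →
        g.Step w (f.toFun^[t] z₁) → f.Iter n' z₁ z →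
        ∃ k w' j, g.Iter k w w' ∧ w' ∈ g.dom ∧ f.Iter j w' z ∧ j ≤ max L R ∧
          (j = 0 ∨ z ∉ Ioo g.a g.b) ∧ (w' ≠ f.c → ∀ i < j, f.toFun^[i] w' ≠ f.c) := by
      intro n' t z₁ hnn hwc ht hst₁ hav hret hst hz
      rcases lt_or_ge n' t with hn | hn
      · refine ⟨0, w, n, rfl, hw, h, by lia, Or.inr ?_, fun h => absurd hwc h⟩
        rw [← hz.eq_of_avoids fun j hj => hav j (by lia)]
        exact hret n' hn
      · obtain ⟨k, w', j, h₁, h₂⟩ := ih (n' - t) (by lia) (hz.drop hn hav) hst.mem_dom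
        exact ⟨k + 1, w', j, ⟨_, hst, h₁⟩, h₂⟩
    rcases lt_trichotomy w f.c with hwc | hwc | hwc
    · have hw' : w ∈ Ico g.a f.c := ⟨hw.1, hwc⟩
      exact key L hg.left_pos (le_max_left _ _) (hg.avoids_left w hw') (hg.no_return_left w hw')
        (hg.eq_left w hw' ▸ hg.step_toFun hw hwc.ne)
    · rcases n with _ | n'
      · exact ⟨0, w, 0, rfl, hw, h, by lia, Or.inl rfl, fun _ i hi => by lia⟩
      obtain ⟨z₁, hz₁, hz⟩ := h
      obtain ⟨t, rfl⟩ : ∃ t, R = t + 1 := ⟨R - 1, by have := hg.right_pos; lia⟩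
      obtain ⟨s, rfl⟩ : ∃ t, L = t + 1 := ⟨L - 1, by have := hg.left_pos; lia⟩
      obtain ⟨-, ⟨hne, -⟩ | ⟨-, rfl | rfl⟩⟩ := id hz₁
      · exact absurd hwc hne
      · have hp : ∀ j < t, f.plus^[j] f.a ∉ Ioo g.a g.b := fun j hj => by
          have := hg.plus_no_return (j := j + 1) (by lia) (by lia)
          rwa [Function.iterate_succ_apply, plus_c] at this
        have hpc : ∀ j < t, f.plus^[j] f.a ≠ f.c := fun j hj e => hp j hj (e ▸ hg.c_mem_Ioo)
        have he : ∀ j ≤ t, f.plus^[j] f.a = f.toFun^[j] f.a := fun j hj =>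
          plus_iterate_eq' fun i hi => hpc i (by lia)
        refine keyc n' t f.a rfl hwc (le_max_right _ _) hz₁ (fun j hj => he j hj.le ▸ hpc j hj)
          (fun j hj => he j hj.le ▸ hp j hj) ?_ hz
        rw [← he t le_rfl, ← plus_c, ← Function.iterate_succ_apply, hg.plus_iterate_c]
        exact ⟨hw, Or.inr ⟨hwc.trans hg.c_eq.symm, Or.inl rfl⟩⟩
      · have hp : ∀ j < s, f.minus^[j] f.b ∉ Ioo g.a g.b := fun j hj => by
          have := hg.minus_no_return (j := j + 1) (by lia) (by lia)
          rwa [Function.iterate_succ_apply, minus_c] at this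
        have hpc : ∀ j < s, f.minus^[j] f.b ≠ f.c := fun j hj e => hp j hj (e ▸ hg.c_mem_Ioo)
        have he : ∀ j ≤ s, f.minus^[j] f.b = f.toFun^[j] f.b := fun j hj =>
          minus_iterate_eq' fun i hi => hpc i (by lia)
        refine keyc n' s f.b rfl hwc (le_max_left _ _) hz₁ (fun j hj => he j hj.le ▸ hpc j hj)
          (fun j hj => he j hj.le ▸ hp j hj) ?_ hz
        rw [← he s le_rfl, ← minus_c, ← Function.iterate_succ_apply, hg.minus_iterate_c]
        exact ⟨hw, Or.inr ⟨hwc.trans hg.c_eq.symm, Or.inr rfl⟩⟩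
    · have hw' : w ∈ Ioc f.c g.b := ⟨hwc, hw.2⟩
      exact key R hg.right_pos (le_max_right _ _) (hg.avoids_right w hw') (hg.no_return_right w hw')
        (hg.eq_right w hw' ▸ hg.step_toFun hw hwc.ne')

/-- Inside the domain of a first return map `g`, orbits of `f` are orbits of `g`. -/
theorem mem_orb_of_mem_orb (hg : f.IsReturn g L R) {S : Set ℝ} (hS : S ⊆ g.dom) {y : ℝ}
    (hy : y ∈ Ioo g.a g.b) (h : y ∈ f.orb S) : y ∈ g.orb S := by
  obtain ⟨x, hx, n, hn⟩ := h
  obtain ⟨k, w', j, h₁, -, h₂, -, h₃ | h₃, -⟩ := hg.factor hn (hS hx)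
  · subst h₃
    obtain rfl : w' = y := h₂
    exact ⟨x, hx, k, h₁⟩
  · exact absurd hy h₃

end IsReturn

/-- If the left endpoint is fixed, all limit sets are the whole interval. -/
theorem IsExpanding.c_mem_alpha_of_fixed (hf : f.IsExpanding) (ha : f.toFun f.a = f.a) {y : ℝ}
    (hy : y ∈ f.dom) : f.c ∈ f.alpha y := by
  have main : ∀ y ∈ Ioo f.a f.b, f.c ∈ f.alpha y := by
    intro y hy
    have hac : f.toFun '' Ioo f.a f.c = Ioo f.a f.b := by
      rw [(f.image_Ioo le_rfl f.a_lt_c f.c_lt_b.le (by simp)).2, plus_of_ne f.a_lt_c.ne, ha, minus_c]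
    have hfa : ∀ n, f.plus^[n] f.a = f.a := by
      intro n
      induction n with
      | zero => rfl
      | succ n ih => rw [Function.iterate_succ_apply', ih, plus_of_ne f.a_lt_c.ne, ha]
    -- Arbitrarily close to the fixed point `a` there are preimages of `y` of every large order. The
    -- left branch maps `(a, c)` onto `(a, b)`, so `y` can be pulled back inside `(a, c)` as often
    -- as desired. An iterate of `(a, q)` covers `(a, c)`, and one more pullback brings the preimage
    -- into `(a, q)`.
    have deep : ∀ q, f.a < q → q ≤ f.b → ∃ n, ∀ m ≥ n, ∃ w ∈ Ioo f.a q, f.Iter m w y := by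
      intro q hq hqb
      obtain ⟨n, hn, hc⟩ := hf.exists_first le_rfl hq hqb
      have himg := (hn.image_Ioo le_rfl hq hqb).2
      rw [hfa] at himg hc
      refine ⟨n + 1, fun m hm => ?_⟩
      obtain ⟨d, rfl⟩ := Nat.exists_eq_add_of_le' hm
      have hback : ∃ w ∈ Ioo f.a f.c, f.Iter (d + 1) w y := by
        clear hm
        induction d with
        | zero =>
          obtain ⟨w, hw, rfl⟩ := hac.symm ▸ hy
          exact ⟨w, hw, iter_one.2 ⟨⟨hw.1.le, hw.2.le.trans f.c_lt_b.le⟩, Or.inl ⟨hw.2.ne, rfl⟩⟩⟩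
        | succ d ih =>
          obtain ⟨w, hw, hwy⟩ := ih
          obtain ⟨w', hw', rfl⟩ := hac.symm ▸ (show w ∈ Ioo f.a f.b from
            ⟨hw.1, hw.2.trans f.c_lt_b⟩)
          exact ⟨w', hw', _, ⟨⟨hw'.1.le, hw'.2.le.trans f.c_lt_b.le⟩, Or.inl ⟨hw'.2.ne, rfl⟩⟩, hwy⟩
      obtain ⟨w, hw, hwy⟩ := hback
      obtain ⟨x, hx, rfl⟩ := himg.symm ▸ (show w ∈ Ioo f.a (f.minus^[n] q) from
        ⟨hw.1, hw.2.trans hc.2⟩)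
      refine ⟨x, hx, ?_⟩
      rw [show d + (n + 1) = n + (d + 1) by ring]
      exact (iter_toFun ⟨hx.1.le, hx.2.le.trans hqb⟩ (hn x hx)).trans hwy
    refine mem_alpha_of_Ioo ⟨f.a_lt_c, f.c_lt_b⟩ fun p q hp hq hc N => ?_
    obtain ⟨h₁, h₂⟩ := f.image_Ioo (p := f.c) (q := q) f.a_lt_c.le hc.2 hq (by simp)
    rw [plus_c] at h₁ h₂
    obtain ⟨n, hn⟩ := deep (f.minus q) h₁ (minus_mem_dom ⟨f.a_lt_c.le.trans hc.2.le, hq⟩).2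
    obtain ⟨w, hw, hwy⟩ := hn (n + N) (by lia)
    obtain ⟨x, hx, rfl⟩ := h₂.symm ▸ hw
    exact ⟨n + N + 1, by lia, x, ⟨hc.1.trans hx.1, hx.2⟩, _,
      ⟨⟨f.a_lt_c.le.trans hx.1.le, hx.2.le.trans hq⟩, Or.inl ⟨hx.1.ne', rfl⟩⟩, hwy⟩
  have hcc := main f.c ⟨f.a_lt_c, f.c_lt_b⟩
  rcases eq_or_lt_of_le hy.1 with rfl | h₁
  · exact (iter_one.2 ⟨c_mem_dom, Or.inr ⟨rfl, Or.inl rfl⟩⟩ : f.Iter 1 f.c f.a).alpha_subset hcc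
  rcases eq_or_lt_of_le hy.2 with rfl | h₂
  · exact (iter_one.2 ⟨c_mem_dom, Or.inr ⟨rfl, Or.inr rfl⟩⟩ : f.Iter 1 f.c f.b).alpha_subset hcc
  exact main y ⟨h₁, h₂⟩

end LorenzMap

/-! ### Gaps around the discontinuity and their return maps. -/

namespace LorenzMap
variable {f g h : LorenzMap} {E : Set ℝ} {em ep : ℝ}

/-- `(em, ep)` is the component of the complement of `E` that contains `c`. -/
structure IsGap (f : LorenzMap) (E : Set ℝ) (em ep : ℝ) : Prop where
  left_mem : em ∈ E
  right_mem : ep ∈ E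
  left_lt : em < f.c
  lt_right : f.c < ep
  disjoint : ∀ z ∈ E, z ∉ Ioo em ep

theorem IsGap.reflect (h : f.IsGap E em ep) : f.reflect.IsGap (Neg.neg ⁻¹' E) (-ep) (-em) where
  left_mem := by simpa using h.right_mem
  right_mem := by simpa using h.left_mem
  left_lt := neg_lt_neg h.lt_right
  lt_right := neg_lt_neg h.left_lt
  disjoint z hz hz' := h.disjoint _ hz ⟨by linarith [hz'.2], by linarith [hz'.1]⟩

theorem IsGap.le_or_ge (h : f.IsGap E em ep) {z : ℝ} (hz : z ∈ E) : z ≤ em ∨ ep ≤ z := by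
  by_contra! hcon
  exact h.disjoint z hz hcon

/-- If `E` were to the right of `c`, its minimum `y` would satisfy `y ≤ f y`, and `[y, b]` would be
mapped into itself without ever meeting `c`. -/
theorem IsInvariant.exists_lt (hf : f.IsExpanding) (hE : f.IsInvariant E) : ∃ z ∈ E, z < f.c := by
  by_contra! H
  have hbdd : BddBelow E := ⟨f.a, fun z hz => (hE.subset hz).1.le⟩
  have hy := hE.isClosed.csInf_mem hE.nonempty hbdd
  set y := sInf E
  have hcy : f.c < y := lt_of_le_of_ne (H y hy) (hE.ne_c hy).symm
  have hyb := (hE.subset hy).2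
  have hyf : y ≤ f.toFun y := csInf_le hbdd (hE.forward y hy)
  refine hf.no_avoid (f.a_lt_c.le.trans hcy.le) hyb le_rfl one_pos (S := Icc y f.b)
    Ioo_subset_Icc_self ?_ ?_
  · intro x hx j hj
    obtain rfl : j = 0 := by lia
    exact (hcy.trans_le hx.1).ne'
  · intro x hx
    exact ⟨hyf.trans (f.strictMonoOn_right.monotoneOn ⟨hcy, hyb.le⟩ ⟨hcy.trans_le hx.1, hx.2⟩ hx.1),
      (f.mapsTo x ⟨f.a_lt_c.le.trans (hcy.le.trans hx.1), hx.2⟩ (hcy.trans_le hx.1).ne').2⟩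

theorem IsInvariant.exists_left (hf : f.IsExpanding) (hE : f.IsInvariant E) :
    ∃ em ∈ E, em < f.c ∧ ∀ z ∈ E, z ∉ Ioo em f.c := by
  have hne : (E ∩ Iic f.c).Nonempty := by
    obtain ⟨z, hz, hzc⟩ := hE.exists_lt hf
    exact ⟨z, hz, hzc.le⟩
  have hbdd : BddAbove (E ∩ Iic f.c) := ⟨f.c, fun z hz => hz.2⟩
  have hy := (hE.isClosed.inter isClosed_Iic).csSup_mem hne hbdd
  refine ⟨_, hy.1, lt_of_le_of_ne hy.2 (hE.ne_c hy.1), fun z hz hz' => ?_⟩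
  exact absurd (le_csSup hbdd ⟨hz, hz'.2.le⟩) hz'.1.not_ge

theorem IsInvariant.exists_isGap (hf : f.IsExpanding) (hE : f.IsInvariant E) :
    ∃ em ep, f.IsGap E em ep := by
  obtain ⟨em, h₁, h₂, h₃⟩ := hE.exists_left hf
  obtain ⟨ep, h₄, h₅, h₆⟩ := hE.reflect.exists_left hf.reflect
  refine ⟨em, -ep, h₁, h₄, h₂, by simp only [reflect_c] at h₅; linarith, fun z hz hz' => ?_⟩
  rcases lt_trichotomy z f.c with h | h | h
  · exact h₃ z hz ⟨hz'.1, h⟩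
  · exact hE.ne_c hz h
  · exact h₆ (-z) (by simpa using hz) ⟨by linarith [hz'.2], by simpa using h⟩

/-- The left branch of the return map to a gap `(em, ep)`. -/
structure LeftBranch (f : LorenzMap) (em ep : ℝ) (l : ℕ) : Prop where
  one_lt : 1 < l
  a_lt : f.a < em
  left_lt : em < f.c
  lt_right : f.c < ep
  avoids : f.Avoids l (Ico em f.c)
  fixed : f.toFun^[l] em = em
  c_lt : f.c < f.minus^[l] f.c
  le : f.minus^[l] f.c ≤ ep
  lt_toFun : ∀ x ∈ Ioo em f.c, x < f.toFun^[l] x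
  no_return : ∀ j, 0 < j → j < l → ∀ x ∈ Ico em f.c, f.toFun^[j] x ∉ Ioo em ep

theorem IsInvariant.avoids_Ico (hE : f.IsInvariant E) (h : em ∈ E) {n : ℕ} {q : ℝ}
    (hn : f.Avoids n (Ioo em q)) : f.Avoids n (Ico em q) := by
  intro x hx
  rcases eq_or_lt_of_le hx.1 with rfl | h'
  · exact fun j _ => hE.iterate_ne_c h j
  · exact hn x ⟨h', hx.2⟩

/-- The image of a gap interval cannot contain a point of `E`. -/
theorem IsInvariant.image_disjoint (hE : f.IsInvariant E) {p q : ℝ} (hp : f.a ≤ p) (hpq : p < q)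
    (hq : q ≤ f.b) {n : ℕ} (hn : f.Avoids n (Ioo p q)) (hd : ∀ z ∈ E, z ∉ Ioo p q) {z : ℝ}
    (hz : z ∈ E) : z ∉ Ioo (f.plus^[n] p) (f.minus^[n] q) := by
  rw [← (hn.image_Ioo hp hpq hq).2]
  rintro ⟨w, hw, rfl⟩
  exact hd w (hE.mem_of_iterate_mem ⟨hp.trans_lt hw.1, hw.2.trans_le hq⟩ (hn w hw) hz) hw

/-- Take the first time `l` at which the image of `(em, c)` contains `c`. Up to then the images
contain no point of `E`. The left end of the last one belongs to `E` and is below `c`, hence is at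
most `em`; were it smaller, the image would contain `em`. In the same way the right end cannot pass
`ep`. Expansion excludes invariant subintervals, which makes the branch move points away from `em`
and forbids earlier returns. -/
theorem IsInvariant.exists_leftBranch (hf : f.IsExpanding) (hE : f.IsInvariant E)
    (hG : f.IsGap E em ep) : ∃ l, f.LeftBranch em ep l := by
  have ham := (hE.subset hG.left_mem).1
  have hpb := (hE.subset hG.right_mem).2
  have hcb := f.c_lt_b.le
  have hd : ∀ z ∈ E, z ∉ Ioo em f.c := fun z hz hz' =>
    hG.disjoint z hz ⟨hz'.1, hz'.2.trans hG.lt_right⟩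
  obtain ⟨l, hl, hc⟩ := hf.exists_first ham.le hG.left_lt hcb
  have hplus : ∀ j, f.plus^[j] em = f.toFun^[j] em := fun j =>
    plus_iterate_eq fun i _ => hE.iterate_ne_c hG.left_mem i
  have hdis : ∀ j ≤ l, ∀ z ∈ E, z ∉ Ioo (f.toFun^[j] em) (f.minus^[j] f.c) := fun j hj z hz => by
    rw [← hplus j]
    exact hE.image_disjoint ham.le hG.left_lt hcb (hl.mono Subset.rfl hj) hd hz
  rw [hplus] at hc
  have hav := hE.avoids_Ico hG.left_mem hl
  have hmem := hE.iterate_mem hG.left_mem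
  have hfix : f.toFun^[l] em = em := by
    rcases hG.le_or_ge (hmem l) with h | h
    · refine h.antisymm (not_lt.1 fun hlt => ?_)
      exact hdis l le_rfl em hG.left_mem ⟨hlt, hG.left_lt.trans hc.2⟩
    · exact absurd (hc.1.trans hG.lt_right) h.not_gt
  have hle : f.minus^[l] f.c ≤ ep := not_lt.1 fun hlt =>
    hdis l le_rfl ep hG.right_mem ⟨hc.1.trans hG.lt_right, hlt⟩
  -- For `l = 0` the right end is `c` itself, and for `l = 1` it is `f(c-) = b`, which is beyond
  -- `ep`.
  have hone : 1 < l := by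
    rcases l with _ | _ | l
    · exact absurd hc.2 (lt_irrefl _)
    · simp only [zero_add, Function.iterate_one, minus_c] at hle
      exact absurd hpb hle.not_gt
    · lia
  have hdom : Ico em f.c ⊆ f.dom := fun x hx => ⟨ham.le.trans hx.1, hx.2.le.trans hcb⟩
  refine ⟨l, hone, ham, hG.left_lt, hG.lt_right, hav, hfix, hc.2, hle, ?_, ?_⟩
  · intro x hx
    by_contra! hlex
    have hmono := (hav.regular ordConnected_Ico hdom).1
    refine hf.no_avoid ham.le hx.1 (hx.2.le.trans hcb) (by lia : 0 < l) (S := Ioo em x) Subset.rfl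
      (hl.mono (Ioo_subset_Ioo_right hx.2.le) le_rfl) ?_
    intro w hw
    have hw' : w ∈ Ico em f.c := ⟨hw.1.le, hw.2.trans hx.2⟩
    refine ⟨?_, (hmono hw' ⟨hx.1.le, hx.2⟩ hw.2).trans_le hlex⟩
    have := hmono ⟨le_rfl, hG.left_lt⟩ hw' hw.1
    rwa [hfix] at this
  · intro j hj hjl x hx hxm
    rcases eq_or_lt_of_le hx.1 with rfl | hx'
    · exact hG.disjoint _ (hmem j) hxm
    have himg := ((hl.mono Subset.rfl hjl.le).image_Ioo ham.le hG.left_lt hcb).2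
    rw [hplus] at himg
    have hxi : f.toFun^[j] x ∈ Ioo (f.toFun^[j] em) (f.minus^[j] f.c) :=
      himg ▸ mem_image_of_mem _ ⟨hx', hx.2⟩
    rcases hG.le_or_ge (hmem j) with h | h
    · rcases eq_or_lt_of_le h with h | h
      -- An earlier image starting at `em` ends at or before `c`, so `(em, c)` would be mapped into
      -- itself.
      · rw [h] at himg
        have hcn : f.c ∉ Ioo em (f.minus^[j] f.c) := by
          rw [← himg]
          rintro ⟨w, hw, e⟩
          exact hl w hw j hjl e
        have hmc : f.minus^[j] f.c ≤ f.c := not_lt.1 fun h => hcn ⟨hG.left_lt, h⟩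
        refine hf.no_avoid ham.le hG.left_lt hcb hj (S := Ioo em f.c) Subset.rfl
          (hl.mono Subset.rfl hjl.le) ?_
        intro w hw
        have : f.toFun^[j] w ∈ Ioo em (f.minus^[j] f.c) := himg ▸ mem_image_of_mem _ hw
        exact ⟨this.1, this.2.trans_le hmc⟩
      · exact hdis j hjl.le em hG.left_mem ⟨h, hxm.1.trans hxi.2⟩
    · exact absurd (hxi.1.trans hxm.2) h.not_gt

namespace LeftBranch
variable {l : ℕ}

theorem dom_subset (hl : f.LeftBranch em ep l) : Ico em f.c ⊆ f.dom :=
  fun _ hx => ⟨hl.a_lt.le.trans hx.1, hx.2.le.trans f.c_lt_b.le⟩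

theorem strictMonoOn (hl : f.LeftBranch em ep l) : StrictMonoOn f.toFun^[l] (Ico em f.c) :=
  (hl.avoids.regular ordConnected_Ico hl.dom_subset).1

theorem image (hl : f.LeftBranch em ep l) :
    f.toFun^[l] '' Ioo em f.c = Ioo em (f.minus^[l] f.c) := by
  have := ((hl.avoids.mono Ioo_subset_Ico_self le_rfl).image_Ioo hl.a_lt.le hl.left_lt
    f.c_lt_b.le).2
  rwa [plus_iterate_eq (hl.avoids em ⟨le_rfl, hl.left_lt⟩), hl.fixed] at this

theorem mapsTo (hl : f.LeftBranch em ep l) {x : ℝ} (hx : x ∈ Ico em f.c) :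
    x ≤ f.toFun^[l] x ∧ f.toFun^[l] x < f.minus^[l] f.c := by
  rcases eq_or_lt_of_le hx.1 with rfl | hx'
  · rw [hl.fixed]; exact ⟨le_rfl, hl.left_lt.trans hl.c_lt⟩
  · have : f.toFun^[l] x ∈ Ioo em (f.minus^[l] f.c) :=
      hl.image ▸ mem_image_of_mem _ ⟨hx', hx.2⟩
    exact ⟨(hl.lt_toFun x ⟨hx', hx.2⟩).le, this.2⟩

/-- Points of the gap to the left of `c` eventually enter the return domain. -/
theorem exists_enter (hl : f.LeftBranch em ep l) (hf : f.IsExpanding) {u : ℝ} (huc : u < f.c)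
    {w : ℝ} (hw : w ∈ Ioo em f.c) :
    ∃ n y, f.Iter n w y ∧ y ∈ Ioo u (f.minus^[l] f.c) := by
  have hsub : Ioc em u ⊆ Ioo em f.c := fun x hx => ⟨hx.1, hx.2.trans_lt huc⟩
  have hiter : ∀ k, (∀ i < k, (f.toFun^[l])^[i] w ∈ Ioc em u) →
      f.Iter (l * k) w ((f.toFun^[l])^[k] w) := by
    intro k
    induction k with
    | zero => intro _; rfl
    | succ k ih =>
      intro h
      have h₁ := Ioo_subset_Ico_self (hsub (h k (by lia)))
      rw [Function.iterate_succ_apply', Nat.mul_succ]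
      exact (ih fun i hi => h i (by lia)).trans
        (iter_toFun (hl.dom_subset h₁) (hl.avoids _ h₁))
  by_cases H : ∀ k, (f.toFun^[l])^[k] w ∈ Ioc em u
  · exfalso
    -- If `w` never left `(em, u]`, neither would the points of `(em, w)`: monotonicity keeps them
    -- between the fixed point `em` and the orbit of `w`.
    refine hf.no_avoid hl.a_lt.le hw.1 (hw.2.le.trans f.c_lt_b.le)
      (by have := hl.one_lt; lia : 0 < l)
      (S := {x | ∀ k, (f.toFun^[l])^[k] x ∈ Ioc em u}) ?_ ?_ ?_
    · intro x hx k
      have : em < (f.toFun^[l])^[k] x ∧ (f.toFun^[l])^[k] x < (f.toFun^[l])^[k] w := by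
        induction k with
        | zero => exact hx
        | succ k ih =>
          have hk := hsub (H k)
          have hx' : (f.toFun^[l])^[k] x ∈ Ico em f.c := ⟨ih.1.le, ih.2.trans hk.2⟩
          rw [Function.iterate_succ_apply', Function.iterate_succ_apply']
          refine ⟨?_, hl.strictMonoOn hx' ⟨hk.1.le, hk.2⟩ ih.2⟩
          have := hl.strictMonoOn ⟨le_rfl, hl.left_lt⟩ hx' ih.1
          rwa [hl.fixed] at this
      exact ⟨this.1, this.2.le.trans (H k).2⟩
    · exact fun x hx => hl.avoids x (Ioo_subset_Ico_self (hsub (hx 0)))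
    · intro x hx k
      rw [← Function.iterate_succ_apply]
      exact hx (k + 1)
  · classical
    push Not at H
    have hmin : ∀ i < Nat.find H, (f.toFun^[l])^[i] w ∈ Ioc em u := fun i hi =>
      not_not.1 (Nat.find_min H hi)
    have hspec := Nat.find_spec H
    refine ⟨_, _, hiter _ hmin, ?_⟩
    have hlt : (f.toFun^[l])^[Nat.find H] w ∈ Ioo em (f.minus^[l] f.c) := by
      rcases hk : Nat.find H with _ | k
      · exact ⟨hw.1, hw.2.trans hl.c_lt⟩
      · rw [Function.iterate_succ_apply', ← hl.image]
        exact mem_image_of_mem _ (hsub (hmin k (by lia)))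
    exact ⟨not_le.1 fun h => hspec ⟨hlt.1, h⟩, hlt.2⟩

/-- Left end points of gaps are determined by the return time. -/
theorem eq_of_eq (hl : f.LeftBranch em ep l) {em' ep' : ℝ}
    (hl' : f.LeftBranch em' ep' l) : em = em' := by
  have key : ∀ {em ep em' ep'}, f.LeftBranch em ep l → f.LeftBranch em' ep' l → ¬ em < em' := by
    intro em ep em' ep' hl hl' hlt
    have := hl.lt_toFun em' ⟨hlt, hl'.left_lt⟩
    rw [hl'.fixed] at this
    exact lt_irrefl _ this
  exact le_antisymm (not_lt.1 (key hl' hl)) (not_lt.1 (key hl hl'))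

end LeftBranch

/-- The right branch of the return map to a gap `(em, ep)`. -/
def RightBranch (f : LorenzMap) (em ep : ℝ) (r : ℕ) : Prop := f.reflect.LeftBranch (-ep) (-em) r

namespace RightBranch
variable {r : ℕ}

theorem lt_b (hr : f.RightBranch em ep r) : ep < f.b := neg_lt_neg_iff.1 hr.a_lt

theorem minus_iterate (r : ℕ) : f.reflect.minus^[r] f.reflect.c = -f.plus^[r] f.c := by
  rw [reflect_minus_iterate, reflect_c, neg_neg]

theorem lt_c (hr : f.RightBranch em ep r) : f.plus^[r] f.c < f.c := by
  have := hr.c_lt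
  rw [minus_iterate, reflect_c] at this
  linarith

theorem le (hr : f.RightBranch em ep r) : em ≤ f.plus^[r] f.c := by
  have := LeftBranch.le hr
  rw [minus_iterate] at this
  linarith

theorem avoids (hr : f.RightBranch em ep r) : f.Avoids r (Ioc f.c ep) :=
  (avoids_reflect.1 (LeftBranch.avoids hr)).mono
    (fun x hx => ⟨by simpa using hx.2, by simpa using hx.1⟩) le_rfl

theorem fixed (hr : f.RightBranch em ep r) : f.toFun^[r] ep = ep := by
  have := LeftBranch.fixed hr
  rwa [reflect_iterate, neg_neg, neg_inj] at this

theorem mapsTo (hr : f.RightBranch em ep r) {x : ℝ} (hx : x ∈ Ioc f.c ep) :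
    f.plus^[r] f.c < f.toFun^[r] x ∧ f.toFun^[r] x ≤ x := by
  have := LeftBranch.mapsTo hr (x := -x) ⟨neg_le_neg hx.2, neg_lt_neg hx.1⟩
  rw [minus_iterate, reflect_iterate, neg_neg] at this
  exact ⟨neg_lt_neg_iff.1 this.2, neg_le_neg_iff.1 this.1⟩

theorem no_return (hr : f.RightBranch em ep r) {j : ℕ} (h₀ : 0 < j) (hj : j < r) {x : ℝ}
    (hx : x ∈ Ioc f.c ep) : f.toFun^[j] x ∉ Ioo em ep := by
  have := LeftBranch.no_return hr j h₀ hj (-x) ⟨neg_le_neg hx.2, neg_lt_neg hx.1⟩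
  rw [reflect_iterate, neg_neg] at this
  exact fun h => this ⟨neg_lt_neg h.2, neg_lt_neg h.1⟩

theorem exists_enter (hr : f.RightBranch em ep r) (hf : f.IsExpanding) {v : ℝ} (hv : f.c < v)
    {w : ℝ} (hw : w ∈ Ioo f.c ep) :
    ∃ n y, f.Iter n w y ∧ y ∈ Ioo (f.plus^[r] f.c) v := by
  obtain ⟨n, y, hy, hm⟩ := LeftBranch.exists_enter hr hf.reflect (u := -v) (neg_lt_neg hv)
    (w := -w) ⟨neg_lt_neg hw.2, neg_lt_neg hw.1⟩
  rw [minus_iterate] at hm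
  refine ⟨n, -y, by simpa [iter_reflect] using hy, ⟨by linarith [hm.2], by linarith [hm.1]⟩⟩

end RightBranch

/-- The return map to a gap, as a Lorenz map. -/
noncomputable def returnMap (f : LorenzMap) {em ep : ℝ} {l r : ℕ} (hl : f.LeftBranch em ep l)
    (hr : f.RightBranch em ep r) : LorenzMap where
  a := f.plus^[r] f.c
  b := f.minus^[l] f.c
  c := f.c
  toFun x := if x < f.c then f.toFun^[l] x else f.toFun^[r] x
  a_lt_c := hr.lt_c
  c_lt_b := hl.c_lt
  mapsTo x hx hxc := by
    rcases lt_or_gt_of_ne hxc with h | h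
    · rw [if_pos h]
      obtain ⟨h₁, h₂⟩ := hl.mapsTo ⟨hr.le.trans hx.1, h⟩
      exact ⟨hx.1.trans h₁, h₂.le⟩
    · rw [if_neg h.not_gt]
      obtain ⟨h₁, h₂⟩ := hr.mapsTo ⟨h, hx.2.trans hl.le⟩
      exact ⟨h₁.le, h₂.trans hx.2⟩
  continuousOn_left := by
    refine ((hl.avoids.regular ordConnected_Ico hl.dom_subset).2.mono
      (Ico_subset_Ico_left hr.le)).congr fun x hx => if_pos hx.2
  continuousOn_right := by
    refine ((hr.avoids.regular ordConnected_Ioc fun x hx => ⟨f.a_lt_c.le.trans hx.1.le,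
      hx.2.trans hr.lt_b.le⟩).2.mono (Ioc_subset_Ioc_right hl.le)).congr fun x hx =>
        if_neg hx.1.not_gt
  strictMonoOn_left := by
    refine (hl.strictMonoOn.mono (Ico_subset_Ico_left hr.le)).congr fun x hx => (if_pos hx.2).symm
  strictMonoOn_right := by
    refine ((hr.avoids.regular ordConnected_Ioc fun x hx => ⟨f.a_lt_c.le.trans hx.1.le,
      hx.2.trans hr.lt_b.le⟩).1.mono (Ioc_subset_Ioc_right hl.le)).congr fun x hx =>
        (if_neg hx.1.not_gt).symm
  tendsto_left := by
    refine ((hl.avoids.mono Ioo_subset_Ico_self le_rfl).tendsto hl.a_lt.le hl.left_lt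
      f.c_lt_b.le).2.congr' ?_
    filter_upwards [self_mem_nhdsWithin] with x hx
    exact (if_pos hx).symm
  tendsto_right := by
    refine ((hr.avoids.mono Ioo_subset_Ioc_self le_rfl).tendsto f.a_lt_c.le hl.lt_right
      hr.lt_b.le).1.congr' ?_
    filter_upwards [self_mem_nhdsWithin] with x hx
    exact (if_neg (not_lt.2 (le_of_lt hx))).symm

section returnMap
variable {l r : ℕ} (hl : f.LeftBranch em ep l) (hr : f.RightBranch em ep r)

@[simp] theorem returnMap_a : (f.returnMap hl hr).a = f.plus^[r] f.c := rfl
@[simp] theorem returnMap_b : (f.returnMap hl hr).b = f.minus^[l] f.c := rfl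
@[simp] theorem returnMap_c : (f.returnMap hl hr).c = f.c := rfl

theorem isReturn_returnMap : f.IsReturn (f.returnMap hl hr) l r where
  c_eq := rfl
  left_pos := by have := hl.one_lt; lia
  right_pos := by have := LeftBranch.one_lt hr; lia
  dom_subset x hx := ⟨hl.a_lt.le.trans (hr.le.trans hx.1), hx.2.trans (hl.le.trans hr.lt_b.le)⟩
  avoids_left := hl.avoids.mono (Ico_subset_Ico_left hr.le) le_rfl
  avoids_right := hr.avoids.mono (Ioc_subset_Ioc_right hl.le) le_rfl
  eq_left _ hx := if_pos hx.2
  eq_right _ hx := if_neg hx.1.not_gt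
  no_return_left x hx j h₀ hj h := hl.no_return j h₀ hj x ⟨hr.le.trans hx.1, hx.2⟩
    ⟨hr.le.trans_lt h.1, h.2.trans_le hl.le⟩
  no_return_right x hx j h₀ hj h := hr.no_return h₀ hj ⟨hx.1, hx.2.trans hl.le⟩
    ⟨hr.le.trans_lt h.1, h.2.trans_le hl.le⟩

/-- If `x` were on the orbit of a point `y` of the domain, the nonempty limit set of `y` under the
return map would be contained in `alpha x`. When the domain is inside the open gap, this contradicts
the gap. When the two share an endpoint, the return map fixes that endpoint, and then all its limit
sets contain `c`. -/
theorem notMem_orb_returnMap (hf : f.IsExpanding) {x : ℝ} (hG : f.IsGap (f.alpha x) em ep)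
    (hc : f.c ∉ f.alpha x) : x ∉ f.orb (f.returnMap hl hr).dom := by
  rintro ⟨y, hy, n, hn⟩
  have hg := isReturn_returnMap hl hr
  have hgx : (f.returnMap hl hr).IsExpanding := hg.isExpanding hf
  have hsub := (hg.alpha_subset y).trans hn.alpha_subset
  rcases eq_or_lt_of_le hr.le with h₁ | h₁
  · have : (f.returnMap hl hr).toFun (f.returnMap hl hr).a = (f.returnMap hl hr).a := by
      rw [hg.eq_left _ ⟨le_rfl, hr.lt_c⟩, returnMap_a, ← h₁, hl.fixed]
    exact hc (hsub (hgx.c_mem_alpha_of_fixed this hy))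
  rcases eq_or_lt_of_le hl.le with h₂ | h₂
  · have : (f.returnMap hl hr).toFun (f.returnMap hl hr).b = (f.returnMap hl hr).b := by
      rw [hg.eq_right (f.returnMap hl hr).b ⟨hl.c_lt, le_rfl⟩, returnMap_b, h₂, hr.fixed]
    have := hgx.reflect.c_mem_alpha_of_fixed (y := -y)
      (by rw [reflect_toFun, reflect_a, neg_neg, this]) (mem_dom_reflect.2 (by simpa using hy))
    rw [alpha_reflect] at this
    exact hc (hsub (by simpa using this))
  · obtain ⟨z, hz⟩ := hgx.alpha_nonempty hy
    have hzd := alpha_subset_dom y hz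
    exact hG.disjoint z (hsub hz) ⟨h₁.trans_le hzd.1, hzd.2.trans_lt h₂⟩

theorem isRenormalization_returnMap {x : ℝ} (hx : x ∈ f.dom)
    (hxo : x ∉ f.orb (f.returnMap hl hr).dom) : f.IsRenormalization (f.returnMap hl hr) l r where
  c_eq := rfl
  one_lt_l := hl.one_lt
  one_lt_r := LeftBranch.one_lt hr
  proper := by
    refine ⟨(isReturn_returnMap hl hr).dom_subset, fun h => ?_⟩
    exact absurd (h f.a_mem_dom).1 (hl.a_lt.trans_le hr.le).not_ge
  defined_left := (isReturn_returnMap hl hr).avoids_left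
  defined_right := (isReturn_returnMap hl hr).avoids_right
  eq_left := (isReturn_returnMap hl hr).eq_left
  eq_right := (isReturn_returnMap hl hr).eq_right
  orb_ne h := hxo (h ▸ hx)

end returnMap

/-- A proper limit set gives rise to a renormalization. -/
theorem IsExpanding.exists_branches (hf : f.IsExpanding) {x : ℝ} (hx : x ∈ f.dom)
    (hc : f.c ∉ f.alpha x) : ∃ em ep l r, ∃ (hl : f.LeftBranch em ep l)
      (hr : f.RightBranch em ep r), f.IsGap (f.alpha x) em ep ∧
      f.IsRenormalization (f.returnMap hl hr) l r := by
  have hE := hf.isInvariant_alpha hx hc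
  obtain ⟨em, ep, hG⟩ := hE.exists_isGap hf
  obtain ⟨l, hl⟩ := hE.exists_leftBranch hf hG
  obtain ⟨r, hr⟩ := hE.reflect.exists_leftBranch hf.reflect hG.reflect
  exact ⟨em, ep, l, r, hl, hr, hG, isRenormalization_returnMap hl hr hx
    (notMem_orb_returnMap hl hr hf hG hc)⟩

end LorenzMap

/-! ### Minimal renormalizations and their position relative to the original map. -/

namespace LorenzMap
variable {f g h : LorenzMap} {E : Set ℝ} {em ep : ℝ}

theorem alpha_disjoint_of_notMem_orb {x : ℝ} (hx : x ∉ f.orb h.dom) {z : ℝ} (hz : z ∈ f.alpha x) :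
    z ∉ Ioo h.a h.b := by
  intro hm
  obtain ⟨k, -, y, hy, -, hyx⟩ := exists_mem_of_mem_alpha hz hm 0
  exact hx ⟨y, Ioo_subset_Icc_self hy, k, hyx⟩

/-- At an earlier time `l`, the image of `(em, c)` would run from a point of `E` to a point of `(c,
ep]`. Its left end is then at most `em`, so the image contains `c`, which the branch avoids before
its return time. -/
theorem LeftBranch.le_of_lt_minus {l l' : ℕ} (hl : f.LeftBranch em ep l') (hE : f.IsInvariant E)
    (hG : f.IsGap E em ep) (hlt : f.c < f.minus^[l] f.c) (hle : f.minus^[l] f.c ≤ ep) :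
    l' ≤ l := by
  by_contra! H
  have himg := ((hl.avoids.mono Ioo_subset_Ico_self H.le).image_Ioo hl.a_lt.le hl.left_lt
    f.c_lt_b.le)
  rw [plus_iterate_eq fun j _ => hE.iterate_ne_c hG.left_mem j] at himg
  rcases hG.le_or_ge (hE.iterate_mem hG.left_mem l) with h | h
  · obtain ⟨w, hw, e⟩ := himg.2.symm ▸ (show f.c ∈ Ioo _ _ from ⟨h.trans_lt hG.left_lt, hlt⟩)
    exact hl.avoids w (Ioo_subset_Ico_self hw) l H e
  · exact absurd (himg.1.trans_le hle) h.not_gt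

/-- The minimal renormalization is the return map to the gap of every limit set of a point that is
not on the orbit of its domain. -/
theorem IsMinimalRenormalization.exists_branches (hf : f.IsExpanding)
    (hm : f.IsMinimalRenormalization h) : ∃ em ep l r, f.LeftBranch em ep l ∧
      f.RightBranch em ep r ∧ f.IsReturn h l r ∧ em ≤ h.a ∧ h.b ≤ ep ∧
      (∃ x ∈ f.dom, x ∉ f.orb h.dom) ∧
      ∀ x ∈ f.dom, x ∉ f.orb h.dom → f.IsGap (f.alpha x) em ep := by
  obtain ⟨l, r, hren, hmin⟩ := hm
  have hdom := hren.proper.1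
  have hac : h.a < f.c := hren.c_eq ▸ h.a_lt_c
  have hcb : f.c < h.b := hren.c_eq ▸ h.c_lt_b
  have hplus := plus_iterate_c_of hren.c_eq (hdom h.b_mem_dom).2 hren.defined_right hren.eq_right
  have hminus := minus_iterate_c_of hren.c_eq (hdom h.a_mem_dom).1 hren.defined_left hren.eq_left
  have key : ∀ x ∈ f.dom, x ∉ f.orb h.dom → ∃ em ep, f.LeftBranch em ep l ∧
      f.RightBranch em ep r ∧ f.IsGap (f.alpha x) em ep := by
    intro x hx hxo
    have hc : f.c ∉ f.alpha x := fun hc => alpha_disjoint_of_notMem_orb hxo hc ⟨hac, hcb⟩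
    have hE := hf.isInvariant_alpha hx hc
    obtain ⟨em, ep, l', r', hl, hr, hG, hren'⟩ := hf.exists_branches hx hc
    obtain ⟨hll, hrr⟩ := hmin _ _ _ hren'
    have hem : em ≤ h.a := not_lt.1 fun hlt =>
      alpha_disjoint_of_notMem_orb hxo hG.left_mem ⟨hlt, hG.left_lt.trans hcb⟩
    have hep : h.b ≤ ep := not_lt.1 fun hlt =>
      alpha_disjoint_of_notMem_orb hxo hG.right_mem ⟨hac.trans hG.lt_right, hlt⟩
    -- Minimality bounds `l` by the return time of the gap. The reverse bound holds because `f^l(c-)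
    -- = h.b` lies in `(c, ep]`.
    obtain rfl : l = l' := hll.antisymm
      (hl.le_of_lt_minus hE hG (hminus ▸ hcb) (hminus ▸ hep))
    obtain rfl : r = r' := hrr.antisymm (LeftBranch.le_of_lt_minus hr hE.reflect hG.reflect
      (by rw [RightBranch.minus_iterate, hplus, reflect_c]; exact neg_lt_neg hac)
      (by rw [RightBranch.minus_iterate, hplus]; exact neg_le_neg hem))
    exact ⟨em, ep, hl, hr, hG⟩
  obtain ⟨x₀, hx₀, hxo₀⟩ : ∃ x ∈ f.dom, x ∉ f.orb h.dom := by
    by_contra! H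
    exact hren.orb_ne ((orb_subset_dom hdom).antisymm H)
  obtain ⟨em, ep, hl, hr, hG⟩ := key x₀ hx₀ hxo₀
  have hem : em ≤ h.a := hplus ▸ hr.le
  have hep : h.b ≤ ep := hminus ▸ hl.le
  refine ⟨em, ep, l, r, hl, hr, ?_, hem, hep, ⟨x₀, hx₀, hxo₀⟩, fun x hx hxo => ?_⟩
  · exact {
      c_eq := hren.c_eq
      left_pos := by have := hren.one_lt_l; lia
      right_pos := by have := hren.one_lt_r; lia
      dom_subset := hdom
      avoids_left := hren.defined_left
      avoids_right := hren.defined_right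
      eq_left := hren.eq_left
      eq_right := hren.eq_right
      no_return_left := fun x hx j h₀ hj h => hl.no_return j h₀ hj x ⟨hem.trans hx.1, hx.2⟩
        ⟨hem.trans_lt h.1, h.2.trans_le hep⟩
      no_return_right := fun x hx j h₀ hj h => hr.no_return h₀ hj ⟨hx.1, hx.2.trans hep⟩
        ⟨hem.trans_lt h.1, h.2.trans_le hep⟩ }
  · obtain ⟨em', ep', hl', hr', hG'⟩ := key x hx hxo
    obtain rfl := hl.eq_of_eq hl'
    obtain rfl : ep = ep' := neg_injective (LeftBranch.eq_of_eq hr hr')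
    exact hG'

/-- Iterates of a return map of `f` are iterates of `f`. -/
theorem IsReturn.unfold {L R : ℕ} (hg : f.IsReturn g L R) {S : Set ℝ} (hS : S.OrdConnected)
    (hd : S ⊆ g.dom) {k : ℕ} (hk : g.Avoids k S) :
    ∃ T, k * min L R ≤ T ∧ (k = 0 → T = 0) ∧ ∀ x ∈ S, g.toFun^[k] x = f.toFun^[T] x ∧
      (∀ j < T, f.toFun^[j] x ≠ f.c) ∧ ∀ j, 0 < j → j < T →
        (f.toFun^[j] x ∉ Ioo g.a g.b ∨ ∃ i, 0 < i ∧ i < k ∧ f.toFun^[j] x = g.toFun^[i] x) := by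
  induction k with
  | zero => exact ⟨0, by simp, fun _ => rfl, fun x _ => ⟨rfl, by simp, by lia⟩⟩
  | succ k ih =>
    obtain ⟨T, hT, hT0, h⟩ := ih (hk.mono Subset.rfl (by lia))
    have key : ∀ M, min L R ≤ M → 0 < M → (∀ x ∈ S, (∀ j < M, f.toFun^[j] (g.toFun^[k] x) ≠ f.c) ∧
        g.toFun (g.toFun^[k] x) = f.toFun^[M] (g.toFun^[k] x) ∧
        ∀ j, 0 < j → j < M → f.toFun^[j] (g.toFun^[k] x) ∉ Ioo g.a g.b) →
        ∃ T, (k + 1) * min L R ≤ T ∧ (k + 1 = 0 → T = 0) ∧ ∀ x ∈ S,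
          g.toFun^[k + 1] x = f.toFun^[T] x ∧ (∀ j < T, f.toFun^[j] x ≠ f.c) ∧
          ∀ j, 0 < j → j < T → (f.toFun^[j] x ∉ Ioo g.a g.b ∨
            ∃ i, 0 < i ∧ i < k + 1 ∧ f.toFun^[j] x = g.toFun^[i] x) := by
      intro M hM hM0 H
      refine ⟨M + T, by rw [Nat.add_mul]; lia, by lia, fun x hx => ?_⟩
      obtain ⟨h₁, h₂, h₃⟩ := h x hx
      obtain ⟨h₄, h₅, h₆⟩ := H x hx
      have hsplit : ∀ j, T ≤ j → f.toFun^[j] x = f.toFun^[j - T] (g.toFun^[k] x) := fun j hj => by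
        rw [h₁, ← Function.iterate_add_apply, Nat.sub_add_cancel hj]
      refine ⟨?_, fun j hj => ?_, fun j h0 hj => ?_⟩
      · rw [Function.iterate_succ_apply', h₅, hsplit _ (by lia), Nat.add_sub_cancel]
      · rcases lt_or_ge j T with hjT | hjT
        · exact h₂ j hjT
        · rw [hsplit j hjT]; exact h₄ _ (by lia)
      · rcases lt_trichotomy j T with hjT | rfl | hjT
        · exact (h₃ j h0 hjT).imp_right fun ⟨i, hi, hik, e⟩ => ⟨i, hi, by lia, e⟩
        -- Time `T` is the `k`-th visit to the domain of `g`. The clause `k = 0 → T = 0` excludes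
        -- the start, since here `T` is positive.
        · exact Or.inr ⟨k, Nat.pos_of_ne_zero fun hk0 => by have := hT0 hk0; lia, by lia, h₁.symm⟩
        · rw [hsplit j hjT.le]
          exact Or.inl (h₆ _ (by lia) (by lia))
    rcases hk.side hS hd with hs | hs
    · simp only [hg.c_eq] at hs
      exact key L (min_le_left _ _) hg.left_pos fun x hx => ⟨hg.avoids_left _ (hs x hx),
        hg.eq_left _ (hs x hx), hg.no_return_left _ (hs x hx)⟩
    · simp only [hg.c_eq] at hs
      exact key R (min_le_right _ _) hg.right_pos fun x hx => ⟨hg.avoids_right _ (hs x hx),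
        hg.eq_right _ (hs x hx), hg.no_return_right _ (hs x hx)⟩

/-- The position of a renormalization `h` of the return map `g` relative to the original map `f`.
The critical interval of `h` is `(em, ep)`. -/
structure IsLevel (f g h : LorenzMap) (em ep : ℝ) : Prop where
  isReturn : ∃ L R, f.IsReturn g L R
  isReturn' : ∃ L R, f.IsReturn h L R
  a_lt : g.a < em
  left_le : em ≤ h.a
  le_right : h.b ≤ ep
  lt_b : ep < g.b
  left_periodic : ∃ T, 0 < T ∧ f.toFun^[T] em = em
  right_periodic : ∃ T, 0 < T ∧ f.toFun^[T] ep = ep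
  enter : ∀ w ∈ Ioo em ep, ∃ n y, f.Iter n w y ∧ y ∈ Ioo h.a h.b
  gap : ∀ x ∈ f.orb g.dom \ f.orb h.dom, f.IsGap (f.alpha x) em ep
  nonempty : (f.orb g.dom \ f.orb h.dom).Nonempty

/-- A branch of `h` takes at least two steps of `g`, each of at least `min L R` steps of `f`, hence
the doubling. The gap known for `g` is also the gap for `f`: its endpoints belong to the smaller
limit set of `g`, and an orbit in `alpha x` that met the gap would enter the interior of the domain
of `h`, against the choice of `x`. -/
theorem IsReturn.isLevel {L R : ℕ} (hf : f.IsExpanding) (hg : f.IsReturn g L R)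
    (hm : g.IsMinimalRenormalization h) :
    (∃ em ep, f.IsLevel g h em ep) ∧
      ∃ L' R', f.IsReturn h L' R' ∧ 2 * min L R ≤ L' ∧ 2 * min L R ≤ R' := by
  have hgx := hg.isExpanding hf
  obtain ⟨em, ep, l, r, hl, hr, hh, hem, hep, ⟨y₀, hy₀, hyo₀⟩, hgap⟩ := hm.exists_branches hgx
  obtain ⟨T, hT, -, hT'⟩ := hg.unfold ordConnected_Ico hl.dom_subset hl.avoids
  obtain ⟨U, hU, -, hU'⟩ := hg.unfold ordConnected_Ioc
    (fun x hx => ⟨g.a_lt_c.le.trans hx.1.le, hx.2.trans hr.lt_b.le⟩) hr.avoids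
  have hl1 := hl.one_lt
  have hr1 := LeftBranch.one_lt hr
  have hpos : 0 < min L R := lt_min hg.left_pos hg.right_pos
  have hT2 : 2 * min L R ≤ T := (Nat.mul_le_mul_right _ hl1).trans hT
  have hU2 : 2 * min L R ≤ U := (Nat.mul_le_mul_right _ hr1).trans hU
  have hc : h.c = f.c := hh.c_eq.trans hg.c_eq
  have hIoo : Ioo h.a h.b ⊆ Ioo g.a g.b := Ioo_subset_Ioo hh.a_le hh.le_b
  have hfh : f.IsReturn h T U := {
    c_eq := hc
    left_pos := by lia
    right_pos := by lia
    dom_subset := hh.dom_subset.trans hg.dom_subset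
    avoids_left := fun x hx => (hT' x ⟨hem.trans hx.1, hg.c_eq ▸ hx.2⟩).2.1
    avoids_right := fun x hx => (hU' x ⟨hg.c_eq ▸ hx.1, hx.2.trans hep⟩).2.1
    eq_left := fun x hx => by
      rw [hh.eq_left x ⟨hx.1, hg.c_eq ▸ hx.2⟩, (hT' x ⟨hem.trans hx.1, hg.c_eq ▸ hx.2⟩).1]
    eq_right := fun x hx => by
      rw [hh.eq_right x ⟨hg.c_eq ▸ hx.1, hx.2⟩, (hU' x ⟨hg.c_eq ▸ hx.1, hx.2.trans hep⟩).1]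
    no_return_left := fun x hx j h₀ hj hmem => by
      rcases (hT' x ⟨hem.trans hx.1, hg.c_eq ▸ hx.2⟩).2.2 j h₀ hj with h' | ⟨i, hi, hil, e⟩
      · exact h' (hIoo hmem)
      · rw [e] at hmem
        exact hh.no_return_left x ⟨hx.1, hg.c_eq ▸ hx.2⟩ i hi hil hmem
    no_return_right := fun x hx j h₀ hj hmem => by
      rcases (hU' x ⟨hg.c_eq ▸ hx.1, hx.2.trans hep⟩).2.2 j h₀ hj with h' | ⟨i, hi, hil, e⟩
      · exact h' (hIoo hmem)
      · rw [e] at hmem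
        exact hh.no_return_right x ⟨hg.c_eq ▸ hx.1, hx.2⟩ i hi hil hmem }
  have henter : ∀ w ∈ Ioo em ep, ∃ n y, f.Iter n w y ∧ y ∈ Ioo h.a h.b := by
    intro w hw
    rcases lt_trichotomy w g.c with hwc | rfl | hwc
    · obtain ⟨n, y, hy, hm⟩ := hl.exists_enter hgx hh.a_lt_c ⟨hw.1, hwc⟩
      rw [hh.minus_iterate_c] at hm
      obtain ⟨n', -, hn'⟩ := hg.iter_of_iter hy
      exact ⟨n', y, hn', hm⟩
    · exact ⟨0, g.c, rfl, hh.c_mem_Ioo⟩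
    · obtain ⟨n, y, hy, hm⟩ := hr.exists_enter hgx hh.c_lt_b ⟨hwc, hw.2⟩
      rw [hh.plus_iterate_c] at hm
      obtain ⟨n', -, hn'⟩ := hg.iter_of_iter hy
      exact ⟨n', y, hn', hm⟩
  refine ⟨⟨em, ep, ⟨L, R, hg⟩, ⟨T, U, hfh⟩, hl.a_lt, hem, hep, hr.lt_b, ⟨T, by lia, ?_⟩,
    ⟨U, by lia, ?_⟩, henter, ?_, ?_⟩, T, U, hfh, hT2, hU2⟩
  · rw [← (hT' em ⟨le_rfl, hl.left_lt⟩).1, hl.fixed]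
  · rw [← (hU' ep ⟨hl.lt_right, le_rfl⟩).1, hr.fixed]
  · rintro x ⟨⟨y, hy, n, hn⟩, hxo⟩
    have hyo : y ∉ g.orb h.dom := fun hyo => hxo (hn.mem_orb (hg.orb_subset hyo))
    have hG := hgap y hy hyo
    have hsub := (hg.alpha_subset y).trans hn.alpha_subset
    have hxc : f.c ∉ f.alpha x := fun hxc => alpha_disjoint_of_notMem_orb hxo hxc hfh.c_mem_Ioo
    have hE := hf.isInvariant_alpha (hn.mem_dom (hg.dom_subset hy)) hxc
    refine ⟨hsub hG.left_mem, hsub hG.right_mem, hg.c_eq ▸ hG.left_lt, hg.c_eq ▸ hG.lt_right, ?_⟩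
    intro z hz hzm
    obtain ⟨k, w, hw, hwm⟩ := henter z hzm
    rw [← hw.eq_of_avoids fun j _ => hE.iterate_ne_c hz j] at hwm
    exact alpha_disjoint_of_notMem_orb hxo (hE.iterate_mem hz k) hwm
  · have hcm : g.c ∈ h.dom := hh.c_mem
    -- The endpoints of the domain of `g` are images of `c`, so they lie on the orbit of the domain
    -- of `h`. Being interior allows the `f`-orbit to be compared with the `g`-orbit.
    have hy₁ : y₀ ∈ Ioo g.a g.b := by
      refine ⟨lt_of_le_of_ne hy₀.1 ?_, lt_of_le_of_ne hy₀.2 ?_⟩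
      · rintro rfl
        exact hyo₀ ⟨g.c, hcm, 1, iter_one.2 ⟨c_mem_dom, Or.inr ⟨rfl, Or.inl rfl⟩⟩⟩
      · rintro rfl
        exact hyo₀ ⟨g.c, hcm, 1, iter_one.2 ⟨c_mem_dom, Or.inr ⟨rfl, Or.inr rfl⟩⟩⟩
    exact ⟨y₀, subset_orb hy₀, fun h' => hyo₀ (hg.mem_orb_of_mem_orb hh.dom_subset hy₁ h')⟩

end LorenzMap

/-! ### Expansion over the gap; limit sets of one level and their topology. -/

namespace LorenzMap
variable {f g h : LorenzMap} {E : Set ℝ} {em ep : ℝ}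

/-- A neighbourhood of a point that never enters `(em, ep)` expands over one half of `(em, ep)`. -/
theorem IsExpanding.exists_covering (hf : f.IsExpanding) {p q z : ℝ}
    (hp : f.a ≤ p) (hq : q ≤ f.b) (hz : z ∈ Ioo p q) (hnever : ∀ n, f.toFun^[n] z ∉ Ioo em ep) :
    ∃ n, f.Avoids n (Ioo p q) ∧
      (Icc em f.c ⊆ Ioo (f.plus^[n] p) (f.minus^[n] q) ∨
        Icc f.c ep ⊆ Ioo (f.plus^[n] p) (f.minus^[n] q)) := by
  have hpq := hz.1.trans hz.2
  obtain ⟨n, hn, hc⟩ := hf.exists_first hp hpq hq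
  have hzn : f.toFun^[n] z ∈ Ioo (f.plus^[n] p) (f.minus^[n] q) :=
    (hn.image_Ioo hp hpq hq).2 ▸ mem_image_of_mem _ hz
  refine ⟨n, hn, ?_⟩
  rcases le_or_gt (f.toFun^[n] z) em with h | h
  · exact Or.inl fun x hx => ⟨hzn.1.trans_le (h.trans hx.1), hx.2.trans_lt hc.2⟩
  · have h' : ep ≤ f.toFun^[n] z := not_lt.1 fun h' => hnever n ⟨h, h'⟩
    exact Or.inr fun x hx => ⟨hc.1.trans_le hx.1, (hx.2.trans h').trans_lt hzn.2⟩

/-- A small neighbourhood of `z` has an iterate covering one half of the gap, and each half contains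
a point of `alpha x` whose nearby deep preimages can be pulled back. The points `e₁` and `e₂` need
not be `em` and `ep`, so the lemma also compares limit sets with nested gaps. -/
theorem IsExpanding.mem_alpha_of_never (hf : f.IsExpanding) {x z e₁ e₂ : ℝ}
    (hz : z ∈ Ioo f.a f.b) (hnever : ∀ n, f.toFun^[n] z ∉ Ioo em ep)
    (h₁ : e₁ ∈ f.alpha x) (h₁' : e₁ ∈ Icc em f.c) (h₂ : e₂ ∈ f.alpha x) (h₂' : e₂ ∈ Icc f.c ep) :
    z ∈ f.alpha x := by
  refine mem_alpha_of_Ioo hz fun p q hp hq hzpq N => ?_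
  obtain ⟨n, hn, h | h⟩ := hf.exists_covering hp hq hzpq hnever
  · exact hn.exists_of_mem_alpha hp (hzpq.1.trans hzpq.2) hq h₁ (h h₁') N
  · exact hn.exists_of_mem_alpha hp (hzpq.1.trans hzpq.2) hq h₂ (h h₂') N

/-- Between any two points there is one whose orbit reaches `c`, and it is not in `E`. -/
theorem IsInvariant.isTotallyDisconnected (hf : f.IsExpanding) (hE : f.IsInvariant E) :
    IsTotallyDisconnected E := by
  intro t ht hpre
  have key : ∀ x ∈ t, ∀ y ∈ t, ¬ x < y := by
    intro x hx y hy hxy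
    obtain ⟨w, hw, n, hn, -⟩ := hf.exists_hit (hE.subset (ht hx)).1.le hxy (hE.subset (ht hy)).2.le
    exact hE.iterate_ne_c (ht (hpre.ordConnected.out hx hy (Ioo_subset_Icc_self hw))) n hn
  intro x hx y hy
  exact le_antisymm (not_lt.1 (key y hy x hx)) (not_lt.1 (key x hx y hy))

/-- The first image of `(p, em)` that contains `c` has its right end in `E` and beyond `c`, hence at
or beyond `ep`. It contains no point of `E`, so it ends exactly at `ep`. -/
theorem IsInvariant.exists_iterate_eq (hf : f.IsExpanding) (hE : f.IsInvariant E)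
    (hG : f.IsGap E em ep) {p : ℝ} (hp : f.a ≤ p) (hpe : p < em) (hd : ∀ z ∈ E, z ∉ Ioo p em) :
    ∃ k, f.toFun^[k] em = ep := by
  have heb := (hE.subset hG.left_mem).2.le
  obtain ⟨k, hk, hc⟩ := hf.exists_first hp hpe heb
  have hdis := fun z (hz : z ∈ E) => hE.image_disjoint hp hpe heb hk hd hz
  have hm : f.minus^[k] em = f.toFun^[k] em :=
    minus_iterate_eq fun j _ => hE.iterate_ne_c hG.left_mem j
  rw [hm] at hc hdis
  refine ⟨k, ?_⟩
  rcases hG.le_or_ge (hE.iterate_mem hG.left_mem k) with h | h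
  · exact absurd (hc.2.trans_le h) hG.left_lt.not_gt
  · refine le_antisymm (not_lt.1 fun hlt => ?_) h
    exact hdis ep hG.right_mem ⟨hc.1.trans hG.lt_right, hlt⟩

/-- If `E` has an isolated point, an end point of its gap is mapped to the other one. -/
theorem IsInvariant.exists_iterate_eq_of_isolated (hf : f.IsExpanding) (hE : f.IsInvariant E)
    (hG : f.IsGap E em ep) {p q z : ℝ} (hp : f.a ≤ p) (hq : q ≤ f.b) (hz : z ∈ E)
    (hzpq : z ∈ Ioo p q) (hiso : ∀ w ∈ E, w ∈ Ioo p q → w = z) :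
    ∃ k, f.toFun^[k] em = ep ∨ f.toFun^[k] ep = em := by
  have hpq := hzpq.1.trans hzpq.2
  obtain ⟨n, hn, h⟩ := hf.exists_covering hp hq hzpq
    fun n => hG.disjoint _ (hE.iterate_mem hz n)
  have himg := (hn.image_Ioo hp hpq hq).2
  -- Backward invariance carries the isolation of `z` over to `f^n z`.
  have huniq : ∀ w ∈ E, w ∈ Ioo (f.plus^[n] p) (f.minus^[n] q) → w = f.toFun^[n] z := by
    intro w hw hwm
    rw [← himg] at hwm
    obtain ⟨y, hy, rfl⟩ := hwm
    rw [hiso y (hE.mem_of_iterate_mem ⟨hp.trans_lt hy.1, hy.2.trans_le hq⟩ (hn y hy) hw) hy]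
  have hpd := plus_iterate_mem_dom (f := f) (x := p) ⟨hp, (hpq.trans_le hq).le⟩ n
  have hqd := minus_iterate_mem_dom (f := f) (x := q) ⟨hp.trans hpq.le, hq⟩ n
  rcases h with h | h
  · have hm := h ⟨le_rfl, hG.left_lt.le⟩
    have he := huniq em hG.left_mem hm
    obtain ⟨k, hk⟩ := hE.exists_iterate_eq hf hG hpd.1 hm.1 fun z hz hzm =>
      hzm.2.ne ((huniq z hz ⟨hzm.1, hzm.2.trans hm.2⟩).trans he.symm)
    exact ⟨k, Or.inl hk⟩
  · have hm := h ⟨hG.lt_right.le, le_rfl⟩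
    have he := huniq ep hG.right_mem hm
    obtain ⟨k, hk⟩ := hE.reflect.exists_iterate_eq hf.reflect hG.reflect
      (p := -f.minus^[n] q) (neg_le_neg hqd.2) (neg_lt_neg hm.2) fun z hz hzm => by
        have h₁ : ep < -z := by linarith [hzm.2]
        have h₂ : -z < f.minus^[n] q := by linarith [hzm.1]
        exact h₁.ne' ((huniq (-z) hz ⟨hm.1.trans h₁, h₂⟩).trans he.symm)
    rw [reflect_iterate, neg_neg, neg_inj] at hk
    exact ⟨k, Or.inr hk⟩

/-- If `em` is mapped to `ep`, it is isolated in `E`. -/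
theorem IsInvariant.isolated_of_iterate_eq (hE : f.IsInvariant E) (hG : f.IsGap E em ep) {k : ℕ}
    (hk : f.toFun^[k] em = ep) :
    ∃ p q, f.a ≤ p ∧ q ≤ f.b ∧ em ∈ Ioo p q ∧ ∀ w ∈ E, w ∈ Ioo p q → w = em := by
  have hem := hE.subset hG.left_mem
  obtain ⟨h₁, h₂⟩ := eventually_avoids hem (n := k) fun j _ => hE.iterate_ne_c hG.left_mem j
  have h₃ : ∀ᶠ w in 𝓝 em, f.c < f.toFun^[k] w :=
    h₁.eventually (eventually_gt_nhds (hk.symm ▸ hG.lt_right))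
  obtain ⟨p, q, hpq, hsub⟩ := mem_nhds_iff_exists_Ioo_subset.1
    ((h₂.and h₃).and ((eventually_gt_nhds hem.1).and (eventually_lt_nhds hG.left_lt)))
  refine ⟨max p f.a, min q f.c, le_max_right _ _, (min_le_right _ _).trans f.c_lt_b.le,
    ⟨max_lt hpq.1 hem.1, lt_min hpq.2 hG.left_lt⟩, fun w hw hwm => ?_⟩
  simp only [mem_Ioo, max_lt_iff, lt_min_iff] at hwm
  rcases lt_trichotomy w em with h | h | h
  -- A point `w` just to the left of `em` would be mapped to the left of `ep` by monotonicity and to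
  -- the right of `c` by continuity, that is, into the gap.
  · have hmono := (Avoids.regular (f := f) (n := k) (ordConnected_Ioo (a := p) (b := q))
      (fun x hx => ⟨(hsub hx).2.1.le, (hsub hx).2.2.le.trans f.c_lt_b.le⟩)
      fun x hx => (hsub hx).1.1).1
    have hwpq : w ∈ Ioo p q := ⟨hwm.1.1, hwm.2.1⟩
    have := hmono hwpq hpq h
    rw [hk] at this
    exact absurd ⟨hG.left_lt.trans (hsub hwpq).1.2, this⟩ (hG.disjoint _ (hE.iterate_mem hw k))
  · exact h
  · exact absurd ⟨h, hwm.2.2.trans hG.lt_right⟩ (hG.disjoint w hw)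

theorem finite_setOf_iter (f : LorenzMap) (N : ℕ) (x : ℝ) : {y | ∃ j ≤ N, f.Iter j x y}.Finite := by
  have key : ∀ j, ∀ x, {y | f.Iter j x y}.Finite := by
    intro j
    induction j with
    | zero => exact fun x => (finite_singleton x).subset fun y hy => (show x = y from hy).symm
    | succ j ih =>
      intro x
      refine ((ih (f.plus x)).union (ih (f.minus x))).subset ?_
      rintro y ⟨z, hz, hzy⟩
      obtain ⟨-, rfl | rfl⟩ := step_iff.1 hz
      · exact Or.inl hzy
      · exact Or.inr hzy
  refine ((finite_Iic N).biUnion fun j _ => key j x).subset ?_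
  rintro y ⟨j, hj, hy⟩
  exact mem_biUnion hj hy

theorem finite_range_iterate {F : ℝ → ℝ} {x : ℝ} {T : ℕ} (hT : 0 < T) (hx : F^[T] x = x) :
    (range fun j => F^[j] x).Finite := by
  refine ((finite_Iio T).image fun j => F^[j] x).subset ?_
  rintro _ ⟨j, rfl⟩
  exact ⟨j % T, Nat.mod_lt _ hT, Function.IsPeriodicPt.iterate_mod_apply hx j⟩

theorem iterate_eq_of_periodic {F : ℝ → ℝ} {x y : ℝ} {T k : ℕ} (hT : 0 < T) (hx : F^[T] x = x)
    (hk : F^[k] x = y) : ∃ n, F^[n] y = x := by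
  -- The point `y` is `k` steps ahead of `x`; completing these to `k * T` steps closes the cycle.
  refine ⟨k * T - k, ?_⟩
  rw [← hk, ← Function.iterate_add_apply, Nat.sub_add_cancel (Nat.le_mul_of_pos_right k hT)]
  exact Function.IsPeriodicPt.const_mul hx k

namespace IsLevel

theorem left_lt (hv : f.IsLevel g h em ep) : em < f.c := by
  obtain ⟨L, R, hh⟩ := hv.isReturn'
  exact hv.left_le.trans_lt hh.a_lt_c

theorem lt_right (hv : f.IsLevel g h em ep) : f.c < ep := by
  obtain ⟨L, R, hh⟩ := hv.isReturn'
  exact hh.c_lt_b.trans_le hv.le_right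

theorem dom_subset (hv : f.IsLevel g h em ep) : g.dom ⊆ f.dom := by
  obtain ⟨L, R, hg⟩ := hv.isReturn
  exact hg.dom_subset

theorem f_a_lt (hv : f.IsLevel g h em ep) : f.a < em :=
  (hv.dom_subset g.a_mem_dom).1.trans_lt hv.a_lt

theorem lt_f_b (hv : f.IsLevel g h em ep) : ep < f.b :=
  hv.lt_b.trans_le (hv.dom_subset g.b_mem_dom).2

theorem c_mem (hv : f.IsLevel g h em ep) : f.c ∈ h.dom := by
  obtain ⟨L, R, hh⟩ := hv.isReturn'
  exact hh.c_mem

variable {x : ℝ}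

theorem c_notMem (hv : f.IsLevel g h em ep) (hx : x ∈ f.orb g.dom \ f.orb h.dom) :
    f.c ∉ f.alpha x := fun hc => (hv.gap x hx).disjoint _ hc ⟨hv.left_lt, hv.lt_right⟩

theorem isInvariant (hv : f.IsLevel g h em ep) (hf : f.IsExpanding)
    (hx : x ∈ f.orb g.dom \ f.orb h.dom) : f.IsInvariant (f.alpha x) :=
  hf.isInvariant_alpha (orb_subset_dom hv.dom_subset hx.1) (hv.c_notMem hx)

/-- A point of the gap has a path into the interior of the domain of `h`, and for an orbit that
avoids `c` this path is the orbit. So the gap and that smaller interval are avoided by the same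
orbits. -/
theorem notMem_of_never (hv : f.IsLevel g h em ep) {z : ℝ}
    (hz : ∀ n, f.toFun^[n] z ∉ Ioo h.a h.b) (n : ℕ) : f.toFun^[n] z ∉ Ioo em ep := by
  intro hm
  obtain ⟨L, R, hh⟩ := hv.isReturn'
  have hne : ∀ j, f.toFun^[j] (f.toFun^[n] z) ≠ f.c := fun j e => by
    rw [← Function.iterate_add_apply] at e
    exact hz _ (e ▸ hh.c_mem_Ioo)
  obtain ⟨k, y, hy, hym⟩ := hv.enter _ hm
  rw [← hy.eq_of_avoids fun j _ => hne j, ← Function.iterate_add_apply] at hym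
  exact hz _ hym

theorem mem_alpha_of_never (hv : f.IsLevel g h em ep) (hf : f.IsExpanding)
    (hx : x ∈ f.orb g.dom \ f.orb h.dom) {z : ℝ} (hz : z ∈ Ioo f.a f.b)
    (hnever : ∀ n, f.toFun^[n] z ∉ Ioo em ep) : z ∈ f.alpha x :=
  hf.mem_alpha_of_never hz hnever (hv.gap x hx).left_mem
    ⟨le_rfl, hv.left_lt.le⟩ (hv.gap x hx).right_mem ⟨hv.lt_right.le, le_rfl⟩

theorem never (hv : f.IsLevel g h em ep) (hf : f.IsExpanding)
    (hx : x ∈ f.orb g.dom \ f.orb h.dom) {z : ℝ} (hz : z ∈ f.alpha x) (n : ℕ) :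
    f.toFun^[n] z ∉ Ioo em ep :=
  (hv.gap x hx).disjoint _ ((hv.isInvariant hf hx).iterate_mem hz n)

theorem alpha_eq (hv : f.IsLevel g h em ep) (hf : f.IsExpanding) {x' : ℝ}
    (hx : x ∈ f.orb g.dom \ f.orb h.dom) (hx' : x' ∈ f.orb g.dom \ f.orb h.dom) :
    f.alpha x = f.alpha x' :=
  Subset.antisymm
    (fun _ hz => hv.mem_alpha_of_never hf hx' ((hv.isInvariant hf hx).subset hz) (hv.never hf hx hz))
    (fun _ hz => hv.mem_alpha_of_never hf hx ((hv.isInvariant hf hx').subset hz)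
      (hv.never hf hx' hz))

theorem alpha_ssubset {k : LorenzMap} {em' ep' x' : ℝ} (hv : f.IsLevel g h em ep)
    (hv' : f.IsLevel h k em' ep') (hf : f.IsExpanding) (hx : x ∈ f.orb g.dom \ f.orb h.dom)
    (hx' : x' ∈ f.orb h.dom \ f.orb k.dom) : f.alpha x ⊂ f.alpha x' := by
  have hem : em < em' := hv.left_le.trans_lt hv'.a_lt
  have hep : ep' < ep := hv'.lt_b.trans_le hv.le_right
  refine ⟨fun z hz => hf.mem_alpha_of_never
    ((hv.isInvariant hf hx).subset hz) (hv.never hf hx hz) (hv'.gap x' hx').left_mem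
    ⟨hem.le, hv'.left_lt.le⟩ (hv'.gap x' hx').right_mem ⟨hv'.lt_right.le, hep.le⟩, fun hsub => ?_⟩
  exact (hv.gap x hx).disjoint _ (hsub (hv'.gap x' hx').left_mem)
    ⟨hem, hv'.left_lt.trans hv.lt_right⟩

theorem mem_repellingSet (hv : f.IsLevel g h em ep) (hf : f.IsExpanding)
    (hx : x ∈ f.orb g.dom \ f.orb h.dom) {z : ℝ} (hz : z ∈ f.alpha x) :
    z ∈ f.repellingSet h := by
  have hE := hv.isInvariant hf hx
  refine ⟨alpha_subset_dom x hz, fun n y hy => ?_⟩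
  rw [← hy.eq_of_avoids fun j _ => hE.iterate_ne_c hz j]
  exact alpha_disjoint_of_notMem_orb hx.2 (hE.iterate_mem hz n)

theorem notMem_repellingSet (hv : f.IsLevel g h em ep) {z : ℝ} (hz : z ∈ Ioo em ep) :
    z ∉ f.repellingSet h := fun hr => by
  obtain ⟨n, y, hy, hm⟩ := hv.enter z hz
  exact hr.2 n y hy hm

theorem critLeft_eq (hv : f.IsLevel g h em ep) (hf : f.IsExpanding) : f.critLeft h = em := by
  obtain ⟨x, hx⟩ := hv.nonempty
  refine IsGreatest.csSup_eq ⟨⟨hv.mem_repellingSet hf hx (hv.gap x hx).left_mem, hv.left_lt⟩, ?_⟩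
  rintro z ⟨hz, hzc⟩
  exact not_lt.1 fun h => hv.notMem_repellingSet ⟨h, hzc.trans hv.lt_right⟩ hz

theorem critRight_eq (hv : f.IsLevel g h em ep) (hf : f.IsExpanding) : f.critRight h = ep := by
  obtain ⟨x, hx⟩ := hv.nonempty
  refine IsLeast.csInf_eq ⟨⟨hv.mem_repellingSet hf hx (hv.gap x hx).right_mem, hv.lt_right⟩, ?_⟩
  rintro z ⟨hz, hzc⟩
  exact not_lt.1 fun h => hv.notMem_repellingSet ⟨hv.left_lt.trans hzc, h⟩ hz

/-- The point `em` is always periodic and its orbit avoids `c`, so only the passage from `em` to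
`ep` is a condition. -/
theorem isPeriodicRenormalization_iff (hv : f.IsLevel g h em ep) (hf : f.IsExpanding) :
    f.IsPeriodicRenormalization h ↔ ∃ k, f.toFun^[k] em = ep := by
  obtain ⟨x, hx⟩ := hv.nonempty
  have hE := hv.isInvariant hf hx
  have hem := (hv.gap x hx).left_mem
  have hiter : ∀ n y, f.Iter n em y ↔ f.toFun^[n] em = y := fun n y =>
    ⟨fun h => h.eq_of_avoids fun j _ => hE.iterate_ne_c hem j,
      fun h => h ▸ iter_toFun (hE.mem_dom hem) fun j _ => hE.iterate_ne_c hem j⟩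
  rw [IsPeriodicRenormalization, hv.critLeft_eq hf, hv.critRight_eq hf]
  simp only [hiter]
  exact and_iff_right hv.left_periodic

theorem isCantorSet (hv : f.IsLevel g h em ep) (hf : f.IsExpanding)
    (hx : x ∈ f.orb g.dom \ f.orb h.dom) (hper : ¬ f.IsPeriodicRenormalization h) :
    IsCantorSet (f.alpha x) := by
  have hE := hv.isInvariant hf hx
  have hG := hv.gap x hx
  refine ⟨hE.nonempty, isCompact_Icc.of_isClosed_subset hE.isClosed (alpha_subset_dom x),
    ⟨hE.isClosed, fun z hz => ?_⟩, hE.isTotallyDisconnected hf⟩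
  rw [accPt_iff_nhds]
  by_contra! H
  obtain ⟨U, hU, hiso⟩ := H
  have hzm := hE.subset hz
  obtain ⟨p, q, hpq, hsub⟩ := mem_nhds_iff_exists_Ioo_subset.1
    (inter_mem hU (Ioo_mem_nhds hzm.1 hzm.2))
  obtain ⟨k, hk⟩ := hE.exists_iterate_eq_of_isolated hf hG (p := max p f.a) (q := min q f.b)
    (le_max_right _ _) (min_le_right _ _) hz ⟨max_lt hpq.1 hzm.1, lt_min hpq.2 hzm.2⟩
    fun w hw hwm => hiso w ⟨(hsub ⟨(le_max_left _ _).trans_lt hwm.1,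
      hwm.2.trans_le (min_le_left _ _)⟩).1, hw⟩
  rw [hv.isPeriodicRenormalization_iff hf] at hper
  rcases hk with hk | hk
  · exact hper ⟨k, hk⟩
  · obtain ⟨T, hT, hT'⟩ := hv.right_periodic
    exact hper (iterate_eq_of_periodic hT hT' hk)

/-- A point `w` on the orbit of the domain of `h` is a boundedly long excursion away from a point
`w'` of that domain. Either `w' = c`, which gives finitely many `w`, or `w'` is in the limit set,
hence is `em` or `ep`, and `w` is on a periodic orbit. If `w` is not on that orbit, its own limit
set has the endpoint `em`. Preimages of `w` then approach `em` inside `alpha x`; as `em` is isolated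
there, `w` is on its orbit. -/
theorem finite_of_isPeriodic (hv : f.IsLevel g h em ep) (hf : f.IsExpanding)
    (hx : x ∈ f.orb g.dom \ f.orb h.dom) (hper : f.IsPeriodicRenormalization h) :
    (f.alpha x ∩ Ioo g.a g.b).Finite := by
  have hE := hv.isInvariant hf hx
  have hG := hv.gap x hx
  obtain ⟨k, hk⟩ := (hv.isPeriodicRenormalization_iff hf).1 hper
  obtain ⟨p, q, hp, hq, hpq, hiso⟩ := hE.isolated_of_iterate_eq hG hk
  obtain ⟨T, hT, hT'⟩ := hv.left_periodic
  obtain ⟨U, hU, hU'⟩ := hv.right_periodic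
  obtain ⟨L, R, hh⟩ := hv.isReturn'
  refine (((finite_range_iterate hT hT').union (finite_range_iterate hU hU')).union
    (f.finite_setOf_iter (max L R) f.c)).subset ?_
  rintro w ⟨hw, hwg⟩
  by_cases hwo : w ∈ f.orb h.dom
  · obtain ⟨y, hy, n, hn⟩ := hwo
    obtain ⟨-, w', j, -, hw', hj, hjm, -, hav⟩ := hh.factor hn hy
    by_cases hwc : w' = f.c
    · exact Or.inr ⟨j, hjm, hwc ▸ hj⟩
    left
    have hav := hav hwc
    have he := hj.eq_of_avoids hav
    have hwab : w' ∈ Ioo f.a f.b := ⟨hv.f_a_lt.trans_le (hv.left_le.trans hw'.1),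
      (hw'.2.trans hv.le_right).trans_lt hv.lt_f_b⟩
    have hwE := hE.mem_of_iterate_mem hwab hav (he.symm ▸ hw)
    rcases hG.le_or_ge hwE with h | h
    · obtain rfl : w' = em := h.antisymm (hv.left_le.trans hw'.1)
      exact Or.inl ⟨j, he⟩
    · obtain rfl : w' = ep := (hw'.2.trans hv.le_right).antisymm h
      exact Or.inr ⟨j, he⟩
  · have hemw : em ∈ f.alpha w :=
      (hv.gap w ⟨subset_orb (Ioo_subset_Icc_self hwg), hwo⟩).left_mem
    obtain ⟨j, -, y, hy, -, hyw⟩ := exists_mem_of_mem_alpha hemw hpq 0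
    rcases hyw.cases with ⟨hav, he⟩ | ⟨i, -, -, -, hi⟩
    · have hyE := hE.mem_of_iterate_mem ⟨hp.trans_lt hy.1, hy.2.trans_le hq⟩ hav (he.symm ▸ hw)
      rw [hiso y hyE hy] at he
      exact Or.inl (Or.inl ⟨j, he⟩)
    · exact absurd ⟨f.c, hv.c_mem, _, hi⟩ hwo

/-- If the orbit of `z` entered `(g.a, g.b)`, an iterate injective near `z` would map the limit set
near `z` into a finite set, so `z` would not be an accumulation point. -/
theorem never_of_mem_derivedSet (hv : f.IsLevel g h em ep) (hf : f.IsExpanding)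
    (hx : x ∈ f.orb g.dom \ f.orb h.dom) (hper : f.IsPeriodicRenormalization h) {z : ℝ}
    (hz : z ∈ derivedSet (f.alpha x)) :
    z ∈ f.alpha x ∧ ∀ n, f.toFun^[n] z ∉ Ioo g.a g.b := by
  have hE := hv.isInvariant hf hx
  have hzE : z ∈ f.alpha x := (isClosed_iff_derivedSet_subset _).1 hE.isClosed hz
  refine ⟨hzE, fun n hn => ?_⟩
  have hzm := hE.subset hzE
  obtain ⟨h₁, h₂⟩ := eventually_avoids hzm (n := n) fun j _ => hE.iterate_ne_c hzE j
  obtain ⟨p, q, hpq, hsub⟩ := mem_nhds_iff_exists_Ioo_subset.1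
    ((h₂.and (h₁.eventually (Ioo_mem_nhds hn.1 hn.2))).and (Ioo_mem_nhds hzm.1 hzm.2))
  have hmono := (Avoids.regular (f := f) (n := n) (ordConnected_Ioo (a := p) (b := q))
      (fun x hx => Ioo_subset_dom (hsub hx).2) fun x hx => (hsub hx).1.1).1
  have hfin : (f.alpha x ∩ Ioo p q).Finite := by
    refine Finite.of_finite_image ((hv.finite_of_isPeriodic hf hx hper).subset ?_)
      (hmono.injOn.mono inter_subset_right)
    rintro _ ⟨w, ⟨hw, hwm⟩, rfl⟩
    exact ⟨hE.iterate_mem hw n, (hsub hwm).1.2⟩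
  refine (Infinite.of_accPt ((mem_derivedSet.1 hz).nhds_inter (Ioo_mem_nhds hpq.1 hpq.2))) ?_
  rwa [inter_comm]

theorem derivedSet_eq {k : LorenzMap} {em' ep' x' : ℝ} (hv : f.IsLevel g h em ep)
    (hv' : f.IsLevel h k em' ep') (hf : f.IsExpanding) (hx : x ∈ f.orb g.dom \ f.orb h.dom)
    (hx' : x' ∈ f.orb h.dom \ f.orb k.dom) (hper : f.IsPeriodicRenormalization k) :
    derivedSet (f.alpha x') = f.alpha x := by
  have hE := hv.isInvariant hf hx
  have hE' := hv'.isInvariant hf hx'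
  have hG' := hv'.gap x' hx'
  have hem : em < em' := hv.left_le.trans_lt hv'.a_lt
  have hep : ep' < ep := hv'.lt_b.trans_le hv.le_right
  refine Subset.antisymm (fun z hz => ?_) fun z hz => ?_
  · obtain ⟨hzE, hn⟩ := hv'.never_of_mem_derivedSet hf hx' hper hz
    exact hv.mem_alpha_of_never hf hx (hE'.subset hzE) (hv.notMem_of_never hn)
  · rw [mem_derivedSet, accPt_iff_nhds]
    intro U hU
    have hzm := hE.subset hz
    obtain ⟨p, q, hpq, hsub⟩ := mem_nhds_iff_exists_Ioo_subset.1
      (inter_mem hU (Ioo_mem_nhds hzm.1 hzm.2))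
    have hp : f.a ≤ max p f.a := le_max_right _ _
    have hq : min q f.b ≤ f.b := min_le_right _ _
    have hzpq : z ∈ Ioo (max p f.a) (min q f.b) := ⟨max_lt hpq.1 hzm.1, lt_min hpq.2 hzm.2⟩
    obtain ⟨n, hn, hcov⟩ := hf.exists_covering hp hq hzpq (hv.never hf hx hz)
    rw [← (hn.image_Ioo hp (hzpq.1.trans hzpq.2) hq).2] at hcov
    -- The endpoint `em'` or `ep'` of the smaller gap lies strictly inside the larger one, which the
    -- orbit of `z` avoids. Hence its preimage near `z` differs from `z`.
    obtain ⟨e, he, he', hei⟩ : ∃ e ∈ f.alpha x', e ∈ Ioo em ep ∧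
        e ∈ f.toFun^[n] '' Ioo (max p f.a) (min q f.b) := by
      rcases hcov with h | h
      · exact ⟨em', hG'.left_mem, ⟨hem, hv'.left_lt.trans hv.lt_right⟩, h ⟨hem.le, hv'.left_lt.le⟩⟩
      · exact ⟨ep', hG'.right_mem, ⟨hv.left_lt.trans hv'.lt_right, hep⟩, h ⟨hv'.lt_right.le, hep.le⟩⟩
    obtain ⟨w, hw, rfl⟩ := hei
    refine ⟨w, ⟨(hsub ⟨(le_max_left _ _).trans_lt hw.1, hw.2.trans_le (min_le_left _ _)⟩).1,
      hE'.mem_of_iterate_mem ⟨hp.trans_lt hw.1, hw.2.trans_le hq⟩ (hn w hw) he⟩, ?_⟩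
    rintro rfl
    exact hv.never hf hx hz n he'

end IsLevel
end LorenzMap

theorem encard_setOf_pos_le (m : ℕ∞) : {i : ℕ | 0 < i ∧ (i : ℕ∞) ≤ m}.encard = m := by
  induction m using ENat.recTopCoe with
  | top =>
    rw [encard_eq_top_iff]
    have : {i : ℕ | 0 < i ∧ (i : ℕ∞) ≤ ⊤} = Ioi 0 := by ext i; simp
    rw [this]
    exact Ioi_infinite 0
  | coe n =>
    have : {i : ℕ | 0 < i ∧ (i : ℕ∞) ≤ n} = ↑(Finset.Ioc 0 n) := by ext i; simp
    rw [this, encard_coe_eq_coe_finsetCard, Nat.card_Ioc, Nat.sub_zero]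

/-! ### The whole sequence of renormalizations. -/

namespace LorenzMap
variable {f : LorenzMap} {m : ℕ∞} {R : ℕ → LorenzMap}

namespace IsRenormalizationSequence

theorem exists_isReturn (hR : f.IsRenormalizationSequence m R) (hf : f.IsExpanding) {i : ℕ}
    (hi : (i : ℕ∞) ≤ m) : ∃ L L', f.IsReturn (R i) L L' ∧ 2 ^ i ≤ L ∧ 2 ^ i ≤ L' := by
  induction i with
  | zero => exact ⟨1, 1, hR.zero ▸ f.isReturn_self, le_rfl, le_rfl⟩
  | succ i ih =>
    have hlt : (i : ℕ∞) < m := lt_of_lt_of_le (by exact_mod_cast i.lt_succ_self) hi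
    obtain ⟨L, L', hg, hL, hL'⟩ := ih hlt.le
    obtain ⟨-, M, M', hh, hM, hM'⟩ := hg.isLevel hf (hR.succ i hlt)
    have := le_min hL hL'
    exact ⟨M, M', hh, by rw [pow_succ]; lia, by rw [pow_succ]; lia⟩

theorem exists_isLevel (hR : f.IsRenormalizationSequence m R) (hf : f.IsExpanding) {i : ℕ}
    (hi : (i : ℕ∞) < m) : ∃ em ep, f.IsLevel (R i) (R (i + 1)) em ep := by
  obtain ⟨L, L', hg, -⟩ := hR.exists_isReturn hf hi.le
  exact (hg.isLevel hf (hR.succ i hi)).1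

/-- The domains of infinitely many renormalizations shrink to the discontinuity. -/
theorem exists_dom_subset (hR : f.IsRenormalizationSequence ⊤ R) (hf : f.IsExpanding) {U : Set ℝ}
    (hU : U ∈ 𝓝 f.c) : ∃ i, (R i).dom ⊆ U := by
  obtain ⟨p, q, hpq, hsub⟩ := mem_nhds_iff_exists_Ioo_subset.1
    (inter_mem hU (Ioo_mem_nhds f.a_lt_c f.c_lt_b))
  have hac : ∀ x ∈ Ioo p q, x ∈ Ioo f.a f.b := fun x hx => (hsub hx).2
  obtain ⟨p', hp'⟩ := exists_between hpq.1
  obtain ⟨q', hq'⟩ := exists_between hpq.2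
  obtain ⟨y, hy, n, hn, -⟩ := hf.exists_hit (hac p' ⟨hp'.1, hp'.2.trans hpq.2⟩).1.le hp'.2
    f.c_lt_b.le
  obtain ⟨y', hy', n', hn', -⟩ := hf.exists_hit f.a_lt_c.le hq'.1
    (hac q' ⟨hpq.1.trans hq'.1, hq'.2⟩).2.le
  -- The points `y` and `y'` reach `c` within `max n n'` steps. The branches of this renormalization
  -- avoid `c` for at least `2 ^ max n n'` steps, which is more, so its domain lies between `y` and
  -- `y'`.
  obtain ⟨L, L', hg, hL, hL'⟩ := hR.exists_isReturn hf (i := max n n') le_top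
  have hlt := (max n n').lt_two_pow_self
  refine ⟨max n n', fun x hx => (hsub ⟨?_, ?_⟩).1⟩
  · refine (hp'.1.trans hy.1).trans_le (le_trans ?_ hx.1)
    exact not_lt.1 fun h => hg.avoids_left y ⟨h.le, hy.2⟩ n (by lia) hn
  · refine (hx.2.trans ?_).trans_lt (hy'.2.trans hq'.2)
    exact not_lt.1 fun h => hg.avoids_right y' ⟨hy'.1, h.le⟩ n' (by lia) hn'

/-- For finite `m`, a limit set of `Rᵐf` without `c` would yield a further renormalization. For `m =
∞`, `alpha x` contains a nonempty limit set inside each of the domains, which shrink to `c`. -/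
theorem c_mem_alpha (hR : f.IsRenormalizationSequence m R) (hf : f.IsExpanding) {x : ℝ}
    (hx : ∀ i : ℕ, (i : ℕ∞) ≤ m → x ∈ f.orb (R i).dom) : f.c ∈ f.alpha x := by
  have hsub : ∀ i : ℕ, (i : ℕ∞) ≤ m → ∃ y ∈ (R i).dom, (R i).alpha y ⊆ f.alpha x := by
    intro i hi
    obtain ⟨L, L', hg, -⟩ := hR.exists_isReturn hf hi
    obtain ⟨y, hy, n, hn⟩ := hx i hi
    exact ⟨y, hy, (hg.alpha_subset y).trans hn.alpha_subset⟩
  induction m using ENat.recTopCoe with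
  | top =>
    by_contra hc
    obtain ⟨i, hi⟩ := hR.exists_dom_subset hf ((isClosed_alpha x).isOpen_compl.mem_nhds hc)
    obtain ⟨L, L', hg, -⟩ := hR.exists_isReturn hf (i := i) le_top
    obtain ⟨y, hy, hyx⟩ := hsub i le_top
    obtain ⟨z, hz⟩ := (hg.isExpanding hf).alpha_nonempty hy
    exact hi (alpha_subset_dom y hz) (hyx hz)
  | coe n =>
    obtain ⟨L, L', hg, -⟩ := hR.exists_isReturn hf (i := n) le_rfl
    obtain ⟨y, hy, hyx⟩ := hsub n le_rfl
    rw [← hg.c_eq]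
    refine hyx (not_not.1 fun hc => hR.final n rfl ?_)
    obtain ⟨em, ep, l, r, hl, hr, -, hren⟩ := (hg.isExpanding hf).exists_branches hy hc
    exact ⟨_, l, r, hren⟩

/-- Every point of a proper limit set belongs to exactly one level. -/
theorem exists_level (hR : f.IsRenormalizationSequence m R) {x : ℝ} (hx : x ∈ f.dom)
    (h : ¬ ∀ i : ℕ, (i : ℕ∞) ≤ m → x ∈ f.orb (R i).dom) :
    ∃ i : ℕ, 0 < i ∧ (i : ℕ∞) ≤ m ∧ x ∈ f.orb (R (i - 1)).dom \ f.orb (R i).dom := by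
  classical
  push Not at h
  obtain ⟨h₁, h₂⟩ := Nat.find_spec h
  have hpos : 0 < Nat.find h := by
    refine Nat.pos_of_ne_zero fun h0 => h₂ ?_
    rw [h0, hR.zero]
    exact subset_orb hx
  refine ⟨_, hpos, h₁, not_not.1 fun hn => ?_, h₂⟩
  exact Nat.find_min h (Nat.sub_lt hpos one_pos)
    ⟨le_trans (by exact_mod_cast Nat.sub_le _ _) h₁, hn⟩

end IsRenormalizationSequence
end LorenzMap

theorem theoremC (f : LorenzMap) (hf : f.IsExpanding) (m : ℕ∞) (R : ℕ → LorenzMap)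
    (hR : f.IsRenormalizationSequence m R) :
    ∃ E : ℕ → Set ℝ,
      -- the proper limit sets form a chain of length `m`
      E 0 = ∅ ∧
      (∀ i : ℕ, (i : ℕ∞) < m → E i ⊂ E (i + 1)) ∧
      (∀ i : ℕ, (i : ℕ∞) ≤ m → E i ⊂ f.dom) ∧
      f.properAlphaLimitSets = {S | ∃ i : ℕ, 0 < i ∧ (i : ℕ∞) ≤ m ∧ S = E i} ∧
      f.properAlphaLimitSets.encard = m ∧
      -- their topology
      (∀ i : ℕ, 0 < i → (i : ℕ∞) ≤ m →
        (¬ f.IsPeriodicRenormalization (R i) → IsCantorSet (E i)) ∧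
        (f.IsPeriodicRenormalization (R i) → derivedSet (E i) = E (i - 1))) ∧
      -- the limit set of every point
      (∀ x ∈ f.dom, ∀ i : ℕ, 0 < i → (i : ℕ∞) ≤ m →
        (f.alpha x = E i ↔ x ∈ f.orb (R (i - 1)).dom \ f.orb (R i).dom)) ∧
      (∀ x ∈ f.dom, f.alpha x = f.dom ↔
        x ∈ ⋂ i : ℕ, ⋂ _ : (i : ℕ∞) ≤ m, f.orb (R i).dom) := by
  -- Since `0 - 1 = 0` in `ℕ`, the set `X 0` is empty, which yields `E 0 = ∅`. For the other
  -- relevant `i`, all sets in the union defining `E i` coincide.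
  set X : ℕ → Set ℝ := fun i => f.orb (R (i - 1)).dom \ f.orb (R i).dom with hX
  set E : ℕ → Set ℝ := fun i => ⋃ x ∈ X i, f.alpha x with hE
  have hlevel : ∀ i : ℕ, 0 < i → (i : ℕ∞) ≤ m → ∃ em ep, f.IsLevel (R (i - 1)) (R i) em ep := by
    intro i hi him
    obtain ⟨j, rfl⟩ : ∃ j, i = j + 1 := ⟨i - 1, by lia⟩
    exact hR.exists_isLevel hf (lt_of_lt_of_le (by exact_mod_cast j.lt_succ_self) him)
  have hEeq : ∀ i : ℕ, 0 < i → (i : ℕ∞) ≤ m → ∀ x ∈ X i, E i = f.alpha x := by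
    intro i hi him x hx
    obtain ⟨em, ep, hv⟩ := hlevel i hi him
    refine Subset.antisymm (iUnion₂_subset fun y hy => (hv.alpha_eq hf hy hx).subset) ?_
    exact subset_biUnion_of_mem (u := fun x => f.alpha x) hx
  have hXne : ∀ i : ℕ, 0 < i → (i : ℕ∞) ≤ m → (X i).Nonempty := by
    intro i hi him
    obtain ⟨em, ep, hv⟩ := hlevel i hi him
    exact hv.nonempty
  have hcE : ∀ i : ℕ, 0 < i → (i : ℕ∞) ≤ m → f.c ∉ E i := by
    intro i hi him
    obtain ⟨em, ep, hv⟩ := hlevel i hi him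
    obtain ⟨x, hx⟩ := hXne i hi him
    rw [hEeq i hi him x hx]
    exact hv.c_notMem hx
  have hE0 : E 0 = ∅ := by simp [hE, hX]
  have hchain : ∀ i : ℕ, (i : ℕ∞) < m → E i ⊂ E (i + 1) := by
    intro i him
    have him' : ((i + 1 : ℕ) : ℕ∞) ≤ m := by exact_mod_cast Order.add_one_le_of_lt him
    obtain ⟨em', ep', hv'⟩ := hlevel (i + 1) (by lia) him'
    obtain ⟨x', hx'⟩ := hXne (i + 1) (by lia) him'
    rw [hEeq (i + 1) (by lia) him' x' hx']
    rcases Nat.eq_zero_or_pos i with rfl | hi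
    · rw [hE0]
      exact empty_ssubset.2 (hv'.isInvariant hf hx').nonempty
    · obtain ⟨em, ep, hv⟩ := hlevel i hi him.le
      obtain ⟨x, hx⟩ := hXne i hi him.le
      rw [hEeq i hi him.le x hx]
      exact hv.alpha_ssubset hv' hf hx hx'
  have hmono : ∀ i j : ℕ, i < j → (j : ℕ∞) ≤ m → E i ⊂ E j := by
    intro i j hij
    induction j, hij using Nat.le_induction with
    | base => exact fun hj => hchain i (lt_of_lt_of_le (by exact_mod_cast i.lt_succ_self) hj)
    | succ j hij ih =>
      intro hj
      have hlt : (j : ℕ∞) < m := lt_of_lt_of_le (by exact_mod_cast j.lt_succ_self) hj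
      exact (ih hlt.le).trans (hchain j hlt)
  have hinj : InjOn E {i : ℕ | 0 < i ∧ (i : ℕ∞) ≤ m} := by
    intro i hi j hj e
    rcases lt_trichotomy i j with h | h | h
    · exact absurd e (hmono i j h hj.2).ne
    · exact h
    · exact absurd e.symm (hmono j i h hi.2).ne
  have hall : ∀ x, (∀ i : ℕ, (i : ℕ∞) ≤ m → x ∈ f.orb (R i).dom) → f.alpha x = f.dom :=
    fun x hx => hf.alpha_eq_dom (hR.c_mem_alpha hf hx)
  have hne : ∀ i : ℕ, 0 < i → (i : ℕ∞) ≤ m → E i ≠ f.dom := fun i hi him e =>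
    hcE i hi him (e ▸ f.c_mem_dom)
  have hproper : f.properAlphaLimitSets = E '' {i : ℕ | 0 < i ∧ (i : ℕ∞) ≤ m} := by
    ext S
    constructor
    · rintro ⟨⟨x, hx, rfl⟩, hS⟩
      obtain ⟨i, hi, him, hxi⟩ := hR.exists_level hx fun h => hS (hall x h)
      exact ⟨i, ⟨hi, him⟩, hEeq i hi him x hxi⟩
    · rintro ⟨i, ⟨hi, him⟩, rfl⟩
      obtain ⟨em, ep, hv⟩ := hlevel i hi him
      obtain ⟨x, hx⟩ := hXne i hi him
      exact ⟨⟨x, LorenzMap.orb_subset_dom hv.dom_subset hx.1, (hEeq i hi him x hx).symm⟩, hne i hi him⟩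
  refine ⟨E, hE0, hchain, ?_, ?_, ?_, ?_, ?_, ?_⟩
  · intro i him
    rcases Nat.eq_zero_or_pos i with rfl | hi
    · rw [hE0]
      exact empty_ssubset.2 ⟨f.c, f.c_mem_dom⟩
    · exact (iUnion₂_subset fun x _ => LorenzMap.alpha_subset_dom x).ssubset_of_ne (hne i hi him)
  · rw [hproper]
    ext S
    constructor
    · rintro ⟨i, ⟨hi, him⟩, rfl⟩
      exact ⟨i, hi, him, rfl⟩
    · rintro ⟨i, hi, him, rfl⟩
      exact ⟨i, ⟨hi, him⟩, rfl⟩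
  · rw [hproper, hinj.encard_image, encard_setOf_pos_le]
  · intro i hi him
    obtain ⟨em, ep, hv⟩ := hlevel i hi him
    obtain ⟨x, hx⟩ := hXne i hi him
    rw [hEeq i hi him x hx]
    refine ⟨hv.isCantorSet hf hx, fun hper => ?_⟩
    rcases Nat.eq_zero_or_pos (i - 1) with h0 | hi'
    -- For `i = 1` the avoided interval is the interior of `I`, and no point of the limit set avoids
    -- it at time `0`.
    · rw [h0, hE0, eq_empty_iff_forall_notMem]
      intro z hz
      rw [h0, hR.zero] at hv
      have hx' : x ∈ f.orb f.dom \ f.orb (R i).dom := by simpa [hX, h0, hR.zero] using hx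
      obtain ⟨hzE, hn⟩ := hv.never_of_mem_derivedSet hf hx' hper hz
      exact hn 0 ((hv.isInvariant hf hx').subset hzE)
    · have him' : ((i - 1 : ℕ) : ℕ∞) ≤ m := le_trans (by exact_mod_cast Nat.sub_le _ _) him
      obtain ⟨em', ep', hv'⟩ := hlevel (i - 1) hi' him'
      obtain ⟨x', hx'⟩ := hXne (i - 1) hi' him'
      rw [hEeq (i - 1) hi' him' x' hx']
      exact hv'.derivedSet_eq hv hf hx' hx hper
  · intro x hx i hi him
    refine ⟨fun e => ?_, fun h => (hEeq i hi him x h).symm⟩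
    obtain ⟨j, hj, hjm, hxj⟩ := hR.exists_level hx fun h => hne i hi him (e ▸ hall x h)
    obtain rfl : j = i := hinj ⟨hj, hjm⟩ ⟨hi, him⟩ ((hEeq j hj hjm x hxj).trans e)
    exact hxj
  · intro x hx
    simp only [mem_iInter]
    refine ⟨fun e => ?_, hall x⟩
    by_contra h
    obtain ⟨j, hj, hjm, hxj⟩ := hR.exists_level hx h
    exact hne j hj hjm ((hEeq j hj hjm x hxj).trans e)
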